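/- Let $f$ be a probability density supported on $[0,1]$ and let $X_1,X_2,\dots$ be i.i.d. with density $f$. A positive sequence $(v_n)_{n\ge1}$ is in $\mathcal{GS}(c)$ if $\lim_{n\to\infty} n\,(1-v_{n-1}/v_n)=c$. Assume: (A1) $f$ has a continuous fourth derivative on $[0,1]$; (A2) $(\gamma_n)\in\mathcal{GS}(-\alpha)$ with $\alpha\in(\tfrac12,1]$; (A3) $(m_n)\in\mathcal{GS}(a)$ with $a\in(0,1)$; (A4) $\lim_{n\to\infty} n\gamma_n$ exists in $\left(\min(2a,(2\alpha-a)/4),\,\infty\right]$. Put $\xi=\lim_{n\to\infty}(n\gamma_n)^{-1}$ (so $\xi=0$ if $n\gamma_n\to\infty$). Let $M_n$ be positive even integers with $M_n/m_n\to1$ (the real numbers $m_n$ rounded to even integer orders). For an integer $m\ge 1$ let $$T_{n,m}(x)=m\sum_{k=0}^{m-1}\mathbb 1\left\{\tfrac km<X_n\le\tfrac{k+1}m\right\}\binom{m-1}{k}x^k(1-x)^{m-1-k},$$ let $Z_n(x)=2T_{n,M_n}(x)-T_{n,M_n/2}(x)$, and define the recursive estimator by $f_0(x)=0$ and $f_n(x)=(1-\gamma_n)f_{n-1}(x)+\gamma_nZ_n(x)$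 for $n\ge1$. Let $$\Delta_2(x)=\tfrac16(1-6x(1-x))f''(x)+\tfrac5{12}x(1-x)(1-2x)f^{(3)}(x)+\tfrac18x^2(1-x)^2f^{(4)}(x),$$ $$\psi(x)=(4\pi x(1-x))^{-1/2},\qquad C_3=\tfrac1{\sqrt2}+4\left(1-\sqrt{2/3}\right),$$ and let $\mathrm{Bias}[f_n(x)]=\mathbb E[f_n(x)]-f(x)$, $\mathrm{MSE}[f_n(x)]=\mathbb E[(f_n(x)-f(x))^2]$. Then, for every fixed $x\in(0,1)$, as $n\to\infty$: 1. If $a\le\frac29\alpha$, then $$\mathrm{Bias}[f_n(x)]=-m_n^{-2}\frac{2}{1-2a\xi}\Delta_2(x)+o(m_n^{-2}).\qquad(\mathrm B)$$ If $a>\frac29\alpha$, then $\mathrm{Bias}[f_n(x)]=o\left(\sqrt{\gamma_nm_n^{1/2}}\right)$. 2. If $a\ge\frac29\alpha$, then $$\mathrm{Var}[f_n(x)]=C_3\gamma_nm_n^{1/2}\frac{2}{4-(2\alpha-a)\xi}f(x)\psi(x)+o(\gamma_nm_n^{1/2}).\qquad(\mathrm V)$$ If $a<\frac29\alpha$, then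 $\mathrm{Var}[f_n(x)]=o(m_n^{-4})$. 3. If $\lim_{n\to\infty} n\gamma_n>\max(2a,(2\alpha-a)/4)$, then $1-2a\xi>0$, $4-(2\alpha-a)\xi>0$, and (B) and (V) hold simultaneously. 4. If $a<\frac29\alpha$, then $$\mathrm{MSE}[f_n(x)]=\Delta_2^2(x)m_n^{-4}\frac{4}{(1-2a\xi)^2}+o(m_n^{-4}).$$ If $a=\frac29\alpha$, then $$\mathrm{MSE}[f_n(x)]=\Delta_2^2(x)m_n^{-4}\frac{4}{(1-2a\xi)^2}+C_3f(x)\psi(x)\gamma_nm_n^{1/2}\frac{2}{4-(2\alpha-a)\xi}+o\left(m_n^{-4}+\gamma_nm_n^{1/2}\right).$$ If $a>\frac29\alpha$, then $$\mathrm{MSE}[f_n(x)]=C_3f(x)\psi(x)\gamma_nm_n^{1/2}\frac{2}{4-(2\alpha-a)\xi}+o(\gamma_nm_n^{1/2}).$$ -/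

import Mathlib

open Filter Asymptotics Topology MeasureTheory ProbabilityTheory

namespace RecBernstein

/-- The class `GS(c)`: positive sequences `(v n)`, `n ≥ 1`, such that
`n * (1 - v (n - 1) / v n) → c`.  The value `v 0` plays no role. -/
def GS (c : ℝ) (v : ℕ → ℝ) : Prop :=
  (∀ n, 1 ≤ n → 0 < v n) ∧
    Tendsto (fun n : ℕ => (n : ℝ) * (1 - v (n - 1) / v n)) atTop (𝓝 c)

/-- `X 1, X 2, …` are independent random variables on `(Ω, μ)`, all having the density `f`
supported on `[0, 1]`. -/
structure IsSample {Ω : Type*} [MeasurableSpace Ω] (μ : Measure Ω) (f : ℝ → ℝ)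
    (X : ℕ → Ω → ℝ) : Prop where
  measurable : ∀ n, 1 ≤ n → Measurable (X n)
  indep : iIndepFun (fun n : ℕ => X (n + 1)) μ
  nonneg : ∀ t ∈ Set.Icc (0 : ℝ) 1, 0 ≤ f t
  law : ∀ n, 1 ≤ n → μ.map (X n) =
    (volume.restrict (Set.Icc (0 : ℝ) 1)).withDensity (fun t => ENNReal.ofReal (f t))

/-- The statistic `T_m(x)` of one observation `y`:
`m * ∑_{k < m} 1{k/m < y ≤ (k+1)/m} * b_k(m-1, x)`, with
`b_k(m-1, x) = (m-1 choose k) x^k (1-x)^(m-1-k)`. -/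
noncomputable def T (m : ℕ) (x y : ℝ) : ℝ :=
  (m : ℝ) * ∑ k ∈ Finset.range m,
    (Set.Ioc ((k : ℝ) / m) (((k : ℝ) + 1) / m)).indicator (fun _ => (1 : ℝ)) y *
      (bernsteinPolynomial ℝ (m - 1) k).eval x

/-- `Z = 2 T_m(x) - T_{m/2}(x)` for one observation `y` (used for even `m`). -/
noncomputable def Z (m : ℕ) (x y : ℝ) : ℝ := 2 * T m x y - T (m / 2) x y

/-- The recursive estimator `f_n(x) = (1 - γ_n) f_{n-1}(x) + γ_n Z_n(x)`, `f_0(x) = 0`, where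
`Z_n(x)` is computed from the observation `X n` with the Bernstein order `M n`. -/
noncomputable def est {Ω : Type*} (γ : ℕ → ℝ) (M : ℕ → ℕ) (X : ℕ → Ω → ℝ) (x : ℝ) :
    ℕ → Ω → ℝ
  | 0 => fun _ => 0
  | n + 1 => fun ω =>
      (1 - γ (n + 1)) * est γ M X x n ω + γ (n + 1) * Z (M (n + 1)) x (X (n + 1) ω)

/-- The bias of an estimator `g` of the number `θ`. -/
noncomputable def bias {Ω : Type*} [MeasurableSpace Ω] (μ : Measure Ω) (g : Ω → ℝ) (θ : ℝ) : ℝ :=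
  (∫ ω, g ω ∂μ) - θ

/-- The mean squared error of an estimator `g` of the number `θ`. -/
noncomputable def mse {Ω : Type*} [MeasurableSpace Ω] (μ : Measure Ω) (g : Ω → ℝ) (θ : ℝ) : ℝ :=
  ∫ ω, (g ω - θ) ^ 2 ∂μ

/-- `Δ₂(x)`, with the derivatives of `f` taken on `[0, 1]`. -/
noncomputable def Delta2 (f : ℝ → ℝ) (x : ℝ) : ℝ :=
  1 / 6 * (1 - 6 * x * (1 - x)) * iteratedDerivWithin 2 f (Set.Icc 0 1) x
    + 5 / 12 * x * (1 - x) * (1 - 2 * x) * iteratedDerivWithin 3 f (Set.Icc 0 1) x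
    + 1 / 8 * x ^ 2 * (1 - x) ^ 2 * iteratedDerivWithin 4 f (Set.Icc 0 1) x

/-- `ψ(x) = (4 π x (1 - x))^(-1/2)`. -/
noncomputable def psi (x : ℝ) : ℝ := (√(4 * Real.pi * x * (1 - x)))⁻¹

/-- `C₃ = 1/√2 + 4 (1 - √(2/3))`. -/
noncomputable def C3 : ℝ := 1 / √2 + 4 * (1 - √(2 / 3))

/-- `Bias[f_n(x)] = -m_n^{-2} * 2 / (1 - 2aξ) * Δ₂(x) + o(m_n^{-2})`. -/
def BiasExpansion (b m : ℕ → ℝ) (f : ℝ → ℝ) (x a ξ : ℝ) : Prop :=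
  (fun n => b n - (-(m n ^ 2)⁻¹ * (2 / (1 - 2 * a * ξ)) * Delta2 f x))
    =o[atTop] fun n => (m n ^ 2)⁻¹

/-- `Var[f_n(x)] = C₃ γ_n m_n^{1/2} * 2 / (4 - (2α - a)ξ) * f(x) ψ(x) + o(γ_n m_n^{1/2})`. -/
def VarExpansion (v γ m : ℕ → ℝ) (f : ℝ → ℝ) (x a α ξ : ℝ) : Prop :=
  (fun n => v n - C3 * γ n * √(m n) * (2 / (4 - (2 * α - a) * ξ)) * f x * psi x)
    =o[atTop] fun n => γ n * √(m n)

end RecBernstein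

/-! Bias and variance obey scalar linear recursions u_{n+1} = (1 - γθ) u_n + γ w, with coefficients
taken at n + 1. For the bias θ = 1 and w is the bias of one Z. For the variance θ = 2 - γ and w = γ
Var Z, because f_n is uncorrelated with the next observation (`IsSample.covariance_est`).

Dividing by a scale s in GS(-σ) turns this into a relaxation recursion for u/s. Its rate tends to θ₀
- σξ and its forcing to c₀ = lim w/s, so u/s tends to c₀ / (θ₀ - σξ) whenever the rate limit is
positive (`tendsto_div_of_recursion`). The bias scale m⁻² has σ = 2a, and the variance scale γ√m has
σ = α - a/2. Both the expansions and the o-statements are instances: a scale on which the forcing is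
negligible gives c₀ = 0. The value a = 2α/9 is where the exponents of m⁻⁴ and γ√m coincide.

It remains to find the mean and variance of one Z. For the mean, a fourth-order Taylor expansion is
integrated against T; the moments of T come from binomial central moments. The 1/m terms cancel in
2T_m - T_{m/2}, and the next ones leave (2 - 4)Δ₂ m⁻² (`tendsto_integral_mul_Z`).

For the variance, T_m², T_m T_{m/2} and T_{m/2}² concentrate at x, so f(x) factors out. Their
integrals are sums of products of binomial weights, which Fourier inversion writes as integrals of
powers of characteristic functions. Laplace's method evaluates these, and C₃ = 4 - 4√(2/3) + 1/√2
collects the three limits (`tendsto_variance_Z`). -/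

namespace RecBernstein

/-! ### Linear recursions and the calculus of the classes GS(c). -/

section Sequences

/-- A contraction recursion with vanishing relative perturbation tends to zero. -/
theorem tendsto_zero_of_contraction {d h ε : ℕ → ℝ}
    (hh : ∀ᶠ n in atTop, 0 ≤ h n ∧ h n ≤ 1)
    (hsum : Tendsto (fun n => ∑ i ∈ Finset.range n, h (i + 1)) atTop atTop)
    (hε : Tendsto ε atTop (𝓝 0))
    (hd : ∀ᶠ n in atTop, |d (n + 1)| ≤ (1 - h (n + 1)) * |d n| + h (n + 1) * ε (n + 1)) :
    Tendsto d atTop (𝓝 0) := by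
  rw [Metric.tendsto_atTop]
  intro η hη
  have h1 : ∀ᶠ n in atTop, ε n < η / 2 := hε.eventually (gt_mem_nhds (by positivity))
  have h2 := (hh.and (h1)).and hd
  obtain ⟨N, hN⟩ := eventually_atTop.1 h2
  -- The excess of |d| over η/2 is multiplied by at most 1 - h ≤ exp(-h) at each step, so it is
  -- bounded by a multiple of exp(-∑ h), which tends to 0.
  have key : ∀ n, N ≤ n → |d n| - η / 2 ≤
      |d N| * Real.exp (∑ i ∈ Finset.range N, h (i + 1) - ∑ i ∈ Finset.range n, h (i + 1)) := by
    intro n hn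
    induction n, hn using Nat.le_induction with
    | base => simp; linarith
    | succ n hn ih =>
      obtain ⟨⟨⟨h0, hle⟩, he⟩, -⟩ := hN (n + 1) (by omega)
      obtain ⟨-, hdn⟩ := hN n hn
      have e1 : |d (n + 1)| - η / 2 ≤ (1 - h (n + 1)) * (|d n| - η / 2) := by nlinarith
      refine e1.trans ?_
      rw [Finset.sum_range_succ]
      set S := ∑ i ∈ Finset.range N, h (i + 1) - ∑ i ∈ Finset.range n, h (i + 1)
      have e2 : ∑ i ∈ Finset.range N, h (i + 1) -
          (∑ i ∈ Finset.range n, h (i + 1) + h (n + 1)) = S + -h (n + 1) := by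
        simp only [S]; ring
      rw [e2, Real.exp_add]
      have e3 : 1 - h (n + 1) ≤ Real.exp (-h (n + 1)) := by
        have := Real.add_one_le_exp (-h (n + 1)); linarith
      calc (1 - h (n + 1)) * (|d n| - η / 2)
          ≤ (1 - h (n + 1)) * (|d N| * Real.exp S) :=
            mul_le_mul_of_nonneg_left ih (by linarith)
        _ ≤ Real.exp (-h (n + 1)) * (|d N| * Real.exp S) :=
            mul_le_mul_of_nonneg_right e3 (by positivity)
        _ = _ := by ring
  have h3 : Tendsto (fun n => |d N| * Real.exp (∑ i ∈ Finset.range N, h (i + 1) -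
      ∑ i ∈ Finset.range n, h (i + 1))) atTop (𝓝 (|d N| * 0)) := by
    refine Tendsto.const_mul _ (Real.tendsto_exp_atBot.comp ?_)
    simpa [sub_eq_add_neg] using tendsto_atBot_add_const_left _ _ (tendsto_neg_atTop_atBot.comp hsum)
  rw [mul_zero] at h3
  obtain ⟨N', hN'⟩ := eventually_atTop.1 (h3.eventually (gt_mem_nhds (half_pos hη)))
  refine ⟨max N N', fun n hn => ?_⟩
  have := key n (le_trans (le_max_left _ _) hn)
  have := hN' n (le_trans (le_max_right _ _) hn)
  rw [Real.dist_eq, sub_zero]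
  linarith

/-- A gain sequence bounded below by `κ / n` has divergent partial sums. -/
theorem tendsto_sum_of_inv_le {g : ℕ → ℝ} {κ : ℝ} (hκ : 0 < κ)
    (hg : ∀ᶠ n : ℕ in atTop, κ / n ≤ g n) :
    Tendsto (fun n => ∑ i ∈ Finset.range n, g (i + 1)) atTop atTop := by
  obtain ⟨N, hN⟩ := eventually_atTop.1 hg
  have h1 : Tendsto (fun n => κ * ∑ i ∈ Finset.range n, (1 / ((i : ℝ) + 1))) atTop atTop :=
    Tendsto.const_mul_atTop hκ Real.tendsto_sum_range_one_div_nat_succ_atTop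
  have h2 := tendsto_atTop_add_const_right atTop
    (∑ i ∈ Finset.range N, g (i + 1) - κ * ∑ i ∈ Finset.range N, (1 / ((i : ℝ) + 1))) h1
  refine tendsto_atTop_mono' _ ?_ h2
  filter_upwards [eventually_ge_atTop N] with n hn
  have : ∀ n, N ≤ n → κ * ∑ i ∈ Finset.range n, (1 / ((i : ℝ) + 1)) +
    (∑ i ∈ Finset.range N, g (i + 1) - κ * ∑ i ∈ Finset.range N, (1 / ((i : ℝ) + 1))) ≤
      ∑ i ∈ Finset.range n, g (i + 1) := by
    intro n hn
    induction n, hn using Nat.le_induction with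
    | base => linarith
    | succ n hn ih =>
      rw [Finset.sum_range_succ, Finset.sum_range_succ, mul_add]
      have := hN (n + 1) (by omega)
      push_cast at this
      rw [div_eq_mul_one_div] at this
      linarith
  exact this n hn

/-- Limit of a linear recursion with small gains `γ` and relaxation rates `δ`. -/
theorem tendsto_of_linear_recursion {r γ δ c : ℕ → ℝ} {δ₀ c₀ κ : ℝ} (hδ₀ : 0 < δ₀) (hκ : 0 < κ)
    (hγ : Tendsto γ atTop (𝓝 0)) (hγκ : ∀ᶠ n : ℕ in atTop, κ / n ≤ γ n)
    (hδ : Tendsto δ atTop (𝓝 δ₀)) (hc : Tendsto c atTop (𝓝 c₀))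
    (hr : ∀ᶠ n in atTop, r (n + 1) = (1 - γ (n + 1) * δ (n + 1)) * r n + γ (n + 1) * c (n + 1)) :
    Tendsto r atTop (𝓝 (c₀ / δ₀)) := by
  have hδ2 : ∀ᶠ n in atTop, δ₀ / 2 < δ n := hδ.eventually (lt_mem_nhds (by linarith))
  have hγ0 : ∀ᶠ n in atTop, 0 ≤ γ n := by
    filter_upwards [hγκ] with n hn
    exact le_trans (by positivity) hn
  have hlim : Tendsto (fun n => r n - c₀ / δ₀) atTop (𝓝 0) := by
    refine tendsto_zero_of_contraction (h := fun n => γ n * δ n)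
      (ε := fun n => |c n / δ n - c₀ / δ₀|) ?_ ?_ ?_ ?_
    · have : Tendsto (fun n => γ n * δ n) atTop (𝓝 0) := by simpa using hγ.mul hδ
      filter_upwards [hγ0, hδ2, this.eventually (ge_mem_nhds (one_pos))] with n h1 h2 h3
      exact ⟨mul_nonneg h1 (by linarith), h3⟩
    · refine tendsto_sum_of_inv_le (g := fun n => γ n * δ n) (κ := κ * (δ₀ / 2)) (by positivity) ?_
      filter_upwards [hγκ, hδ2, hγ0] with n h1 h2 h3
      calc κ * (δ₀ / 2) / n = κ / n * (δ₀ / 2) := by ring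
        _ ≤ γ n * δ n := mul_le_mul h1 h2.le (by positivity) h3
    · have := ((hc.div hδ hδ₀.ne').sub_const (c₀ / δ₀)).abs
      simpa using this
    · have : Tendsto (fun n => γ n * δ n) atTop (𝓝 0) := by simpa using hγ.mul hδ
      filter_upwards [hr, (tendsto_add_atTop_nat 1).eventually hδ2,
        (tendsto_add_atTop_nat 1).eventually hγ0,
        (tendsto_add_atTop_nat 1).eventually (this.eventually (ge_mem_nhds (one_pos)))]
        with n h1 h2 h3 h4
      have hne : δ (n + 1) ≠ 0 := by linarith
      -- The error is a convex combination of the old error and the moving target c/δ minus its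
      -- limit, which is the contraction form with h = γδ.
      have e : r (n + 1) - c₀ / δ₀ = (1 - γ (n + 1) * δ (n + 1)) * (r n - c₀ / δ₀) +
          γ (n + 1) * δ (n + 1) * (c (n + 1) / δ (n + 1) - c₀ / δ₀) := by
        rw [h1]; field_simp; ring
      rw [e]
      refine (abs_add_le _ _).trans (le_of_eq ?_)
      rw [abs_mul, abs_mul, abs_of_nonneg (by linarith : 0 ≤ 1 - γ (n + 1) * δ (n + 1)),
        abs_of_nonneg (mul_nonneg h3 (by linarith : 0 ≤ δ (n + 1)))]
  simpa using hlim.add_const (c₀ / δ₀)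

theorem tendsto_ratio_of_scaled {ρ : ℕ → ℝ} {c : ℝ}
    (h : Tendsto (fun n : ℕ => (n : ℝ) * (1 - ρ n)) atTop (𝓝 c)) : Tendsto ρ atTop (𝓝 1) := by
  have h1 : Tendsto (fun n : ℕ => 1 - ((n : ℝ))⁻¹ * ((n : ℝ) * (1 - ρ n))) atTop
      (𝓝 (1 - 0 * c)) := (tendsto_inv_atTop_nhds_zero_nat.mul h).const_sub 1
  simp only [zero_mul, sub_zero] at h1
  refine h1.congr' ?_
  filter_upwards [eventually_ge_atTop 1] with n hn
  have : (n : ℝ) ≠ 0 := by positivity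
  field_simp
  ring

/-- For consecutive ratios ρ, ρ' tending to 1, 1 - ρρ' = (1 - ρ) + ρ(1 - ρ'). -/
theorem GS.mul {c d : ℝ} {v w : ℕ → ℝ} (hv : GS c v) (hw : GS d w) :
    GS (c + d) (fun n => v n * w n) := by
  refine ⟨fun n hn => mul_pos (hv.1 n hn) (hw.1 n hn), ?_⟩
  have h1 := hv.2.add ((tendsto_ratio_of_scaled hv.2).mul hw.2)
  rw [one_mul] at h1
  refine h1.congr fun n => ?_
  rw [mul_div_mul_comm]
  ring

theorem GS.inv {c : ℝ} {v : ℕ → ℝ} (hv : GS c v) : GS (-c) (fun n => (v n)⁻¹) := by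
  refine ⟨fun n hn => inv_pos.2 (hv.1 n hn), ?_⟩
  have h1 : Tendsto (fun n : ℕ => -((n : ℝ) * (1 - v (n - 1) / v n) / (v (n - 1) / v n))) atTop
      (𝓝 (-(c / 1))) := (hv.2.div (tendsto_ratio_of_scaled hv.2) one_ne_zero).neg
  rw [div_one] at h1
  refine h1.congr' ?_
  filter_upwards [eventually_ge_atTop 2] with n hn
  have h2 := (hv.1 n (by omega)).ne'
  have h3 := (hv.1 (n - 1) (by omega)).ne'
  field_simp
  ring

/-- 1 - √ρ = (1 - ρ) / (1 + √ρ), and the denominator tends to 2. -/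
theorem GS.sqrt {c : ℝ} {v : ℕ → ℝ} (hv : GS c v) : GS (c / 2) (fun n => √(v n)) := by
  refine ⟨fun n hn => Real.sqrt_pos.2 (hv.1 n hn), ?_⟩
  have h0 := tendsto_ratio_of_scaled hv.2
  have h1 : Tendsto (fun n : ℕ => (n : ℝ) * (1 - v (n - 1) / v n) / (1 + √(v (n - 1) / v n)))
      atTop (𝓝 (c / (1 + √1))) := by
    refine hv.2.div ((h0.sqrt).const_add 1) ?_
    positivity
  rw [Real.sqrt_one, one_add_one_eq_two] at h1
  refine h1.congr' ?_
  filter_upwards [eventually_ge_atTop 2] with n hn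
  have h2 := (hv.1 n (by omega))
  have h3 := (hv.1 (n - 1) (by omega))
  have h5 : 0 ≤ v (n - 1) / v n := by positivity
  rw [← Real.sqrt_div' _ h2.le, div_eq_iff (by positivity)]
  nth_rewrite 1 [← Real.sq_sqrt h5]
  ring

/-- The sequence solves its own unforced recursion with gain 1/n and rate n(1 - v_n / v_{n-1}); the
rate tends to -c > 0 because 1/v is in GS(-c). -/
theorem GS.tendsto_zero {c : ℝ} {v : ℕ → ℝ} (hv : GS c v) (hc : c < 0) :
    Tendsto v atTop (𝓝 0) := by
  have h := tendsto_of_linear_recursion (r := v) (γ := fun n => (n : ℝ)⁻¹)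
    (δ := fun n => (n : ℝ) * (1 - (v (n - 1))⁻¹ / (v n)⁻¹)) (c := fun _ => 0) (δ₀ := -c) (c₀ := 0)
    (κ := 1) (by linarith) one_pos
    tendsto_inv_atTop_nhds_zero_nat (Eventually.of_forall fun n => by simp)
    (hv.inv.2.congr fun n => by simp) tendsto_const_nhds ?_
  · simpa using h
  · have h3 := hv.inv.2
    filter_upwards [eventually_ge_atTop 1] with n hn
    have h2 := (hv.1 n (by omega)).ne'
    have h3 := (hv.1 (n + 1) (by omega)).ne'
    have h4 : ((n + 1 : ℕ) : ℝ) ≠ 0 := by positivity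
    rw [Nat.add_sub_cancel]
    field_simp
    ring

theorem GS.tendsto_atTop {c : ℝ} {v : ℕ → ℝ} (hv : GS c v) (hc : 0 < c) :
    Tendsto v atTop atTop := by
  have h := hv.inv.tendsto_zero (by linarith)
  have h1 : Tendsto (fun n => (v n)⁻¹) atTop (𝓝[>] 0) := by
    refine tendsto_nhdsWithin_iff.2 ⟨h, ?_⟩
    filter_upwards [eventually_ge_atTop 1] with n hn using inv_pos.2 (hv.1 n hn)
  exact (h1.inv_tendsto_nhdsGT_zero).congr fun n => by simp

/-- Asymptotics of a linear recursion on the scale of a sequence `s ∈ GS(-σ)`. -/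
theorem tendsto_div_of_recursion {u γ θ w s : ℕ → ℝ} {θ₀ σ ξ c₀ κ : ℝ}
    (hκ : 0 < κ) (hγ : Tendsto γ atTop (𝓝 0)) (hγκ : ∀ᶠ n : ℕ in atTop, κ / n ≤ γ n)
    (hξ : Tendsto (fun n : ℕ => ((n : ℝ) * γ n)⁻¹) atTop (𝓝 ξ))
    (hθ : Tendsto θ atTop (𝓝 θ₀)) (hs : GS (-σ) s) (hpos : 0 < θ₀ - σ * ξ)
    (hw : Tendsto (fun n => w n / s n) atTop (𝓝 c₀))
    (hu : ∀ n, u (n + 1) = (1 - γ (n + 1) * θ (n + 1)) * u n + γ (n + 1) * w (n + 1)) :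
    Tendsto (fun n => u n / s n) atTop (𝓝 (c₀ / (θ₀ - σ * ξ))) := by
  -- With ρ = s_{n-1}/s_n, the factor (1 - γθ)ρ equals 1 - γδ for δ = θρ + (1 - ρ)/γ. Writing (1 -
  -- ρ)/γ as n(1 - ρ) · (nγ)⁻¹ exhibits its limit -σξ.
  refine tendsto_of_linear_recursion (γ := γ)
    (δ := fun n => θ n * (s (n - 1) / s n) + ((n : ℝ) * (1 - s (n - 1) / s n)) * ((n : ℝ) * γ n)⁻¹)
    (c := fun n => w n / s n) hpos hκ hγ hγκ ?_ hw ?_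
  · have := (hθ.mul (tendsto_ratio_of_scaled hs.2)).add (hs.2.mul hξ)
    convert this using 2
    ring
  · filter_upwards [eventually_ge_atTop 1, (tendsto_add_atTop_nat 1).eventually hγκ]
      with n hn hk
    have h2 := (hs.1 n (by omega)).ne'
    have h3 := (hs.1 (n + 1) (by omega)).ne'
    have h4 : ((n + 1 : ℕ) : ℝ) ≠ 0 := by positivity
    have h5 : γ (n + 1) ≠ 0 := (lt_of_lt_of_le (by positivity) hk).ne'
    rw [Nat.add_sub_cancel, hu]
    field_simp
    ring

end Sequences

/-! ### Central moments of the binomial law up to order six. -/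

section Binomial

/-- The binomial weight `(n choose k) x^k (1-x)^(n-k)`. -/
noncomputable def bw (n : ℕ) (x : ℝ) (k : ℕ) : ℝ := (bernsteinPolynomial ℝ n k).eval x

theorem bw_eq (n : ℕ) (x : ℝ) (k : ℕ) : bw n x k = n.choose k * x ^ k * (1 - x) ^ (n - k) := by
  simp [bw, bernsteinPolynomial]

theorem bw_nonneg {x : ℝ} (hx : x ∈ Set.Ioo (0 : ℝ) 1) (n k : ℕ) : 0 ≤ bw n x k := by
  have h0 := hx.1.le
  have h1 : 0 ≤ 1 - x := by linarith [hx.2]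
  rw [bw_eq]; positivity

/-- The expectation of `φ` under the binomial law with parameters `n` and `x`. -/
noncomputable def binomMean (n : ℕ) (x : ℝ) (φ : ℕ → ℝ) : ℝ :=
  ∑ k ∈ Finset.range (n + 1), bw n x k * φ k

theorem bw_succ_succ (n : ℕ) (x : ℝ) (k : ℕ) :
    bw (n + 1) x (k + 1) = (1 - x) * bw n x (k + 1) + x * bw n x k := by
  simp only [bw_eq, Nat.choose_succ_succ, Nat.succ_eq_add_one, Nat.cast_add, Nat.add_sub_add_right]
  rcases lt_or_ge k n with h | h
  · obtain ⟨j, rfl⟩ : ∃ j, n = k + 1 + j := ⟨n - (k + 1), by omega⟩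
    have e1 : k + 1 + j - k = j + 1 := by omega
    have e2 : k + 1 + j - (k + 1) = j := by omega
    rw [e1, e2]; ring
  · rw [Nat.choose_eq_zero_of_lt (by omega : n < k + 1)]
    simp; ring

/-- Conditioning on the last Bernoulli trial. -/
theorem binomMean_succ (n : ℕ) (x : ℝ) (φ : ℕ → ℝ) :
    binomMean (n + 1) x φ =
      (1 - x) * binomMean n x φ + x * binomMean n x (fun k => φ (k + 1)) := by
  have h0 : bw (n + 1) x 0 = (1 - x) * bw n x 0 := by simp [bw_eq, pow_succ']
  have h1 : binomMean n x φ = ∑ k ∈ Finset.range (n + 2), bw n x k * φ k := by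
    rw [Finset.sum_range_succ, bw_eq n x (n + 1)]
    simp [binomMean]
  rw [h1, binomMean, binomMean, Finset.sum_range_succ', Finset.sum_range_succ' _ (n + 1), h0,
    mul_add, Finset.mul_sum, Finset.mul_sum]
  have h2 : ∀ k, bw (n + 1) x (k + 1) * φ (k + 1) =
      (1 - x) * (bw n x (k + 1) * φ (k + 1)) + x * (bw n x k * φ (k + 1)) := fun k => by
    rw [bw_succ_succ]; ring
  simp only [h2, Finset.sum_add_distrib]
  ring

/-- The central moments of the binomial law. -/
noncomputable def binomMoment (n : ℕ) (x : ℝ) (j : ℕ) : ℝ :=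
  binomMean n x fun k => ((k : ℝ) - n * x) ^ j

theorem binomMean_shift (n : ℕ) (x d : ℝ) (j : ℕ) :
    binomMean n x (fun k => ((k : ℝ) - n * x + d) ^ j) =
      ∑ i ∈ Finset.range (j + 1), binomMoment n x i * (d ^ (j - i) * j.choose i) := by
  simp only [binomMoment, binomMean, Finset.sum_mul]
  rw [Finset.sum_comm]
  refine Finset.sum_congr rfl fun k _ => ?_
  rw [add_pow, Finset.mul_sum]
  exact Finset.sum_congr rfl fun _ _ => by ring

/-- One more trial shifts the centred count by -x with probability 1 - x, or by 1 - x with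
probability x. The moments of order one to six then follow one after another by induction on n. -/
theorem binomMoment_succ (n : ℕ) (x : ℝ) (j : ℕ) :
    binomMoment (n + 1) x j =
      (1 - x) * ∑ i ∈ Finset.range (j + 1), binomMoment n x i * ((-x) ^ (j - i) * j.choose i) +
      x * ∑ i ∈ Finset.range (j + 1), binomMoment n x i * ((1 - x) ^ (j - i) * j.choose i) := by
  rw [← binomMean_shift, ← binomMean_shift, binomMoment, binomMean_succ]
  congr 3 <;> funext k <;> push_cast <;> ring

theorem binomMoment_zero_left (x : ℝ) (j : ℕ) : binomMoment 0 x j = 0 ^ j := by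
  simp [binomMoment, binomMean, bw_eq]

theorem binomMoment_zero (n : ℕ) (x : ℝ) : binomMoment n x 0 = 1 := by
  induction n with
  | zero => simp [binomMoment_zero_left]
  | succ n ih => simp [binomMoment_succ, ih]

theorem binomMoment_one (n : ℕ) (x : ℝ) : binomMoment n x 1 = 0 := by
  induction n with
  | zero => simp [binomMoment_zero_left]
  | succ n ih => simp [binomMoment_succ, Finset.sum_range_succ, ih, binomMoment_zero]; ring

theorem binomMoment_two (n : ℕ) (x : ℝ) : binomMoment n x 2 = n * (x * (1 - x)) := by
  induction n with
  | zero => simp [binomMoment_zero_left]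
  | succ n ih =>
    simp [binomMoment_succ, Finset.sum_range_succ, ih, binomMoment_zero, binomMoment_one]; ring

theorem binomMoment_three (n : ℕ) (x : ℝ) :
    binomMoment n x 3 = n * (x * (1 - x)) * (1 - 2 * x) := by
  induction n with
  | zero => simp [binomMoment_zero_left]
  | succ n ih =>
    simp [binomMoment_succ, Finset.sum_range_succ, ih, binomMoment_zero, binomMoment_one,
      binomMoment_two]; ring

theorem binomMoment_four (n : ℕ) (x : ℝ) :
    binomMoment n x 4 = n * (x * (1 - x)) * (1 - 6 * (x * (1 - x))) +
      3 * n ^ 2 * (x * (1 - x)) ^ 2 := by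
  induction n with
  | zero => simp [binomMoment_zero_left]
  | succ n ih =>
    simp [binomMoment_succ, Finset.sum_range_succ, ih, binomMoment_zero, binomMoment_one,
      binomMoment_two, binomMoment_three, Nat.choose]; ring

theorem binomMoment_five (n : ℕ) (x : ℝ) :
    binomMoment n x 5 = n * (x * (1 - x)) * (1 - 2 * x) * (1 - 12 * (x * (1 - x))) +
      10 * n ^ 2 * (x * (1 - x)) ^ 2 * (1 - 2 * x) := by
  induction n with
  | zero => simp [binomMoment_zero_left]
  | succ n ih =>
    simp [binomMoment_succ, Finset.sum_range_succ, ih, binomMoment_zero, binomMoment_one,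
      binomMoment_two, binomMoment_three, binomMoment_four, Nat.choose]; ring

theorem binomMoment_six (n : ℕ) (x : ℝ) :
    binomMoment n x 6 = n * (x * (1 - x)) * (1 - 30 * (x * (1 - x)) + 120 * (x * (1 - x)) ^ 2) +
      n ^ 2 * (x * (1 - x)) ^ 2 * (15 * (1 - 6 * (x * (1 - x))) + 10 * (1 - 4 * (x * (1 - x)))) +
      15 * n ^ 3 * (x * (1 - x)) ^ 3 := by
  induction n with
  | zero => simp [binomMoment_zero_left]
  | succ n ih =>
    simp [binomMoment_succ, Finset.sum_range_succ, ih, binomMoment_zero, binomMoment_one,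
      binomMoment_two, binomMoment_three, binomMoment_four, binomMoment_five, Nat.choose]; ring

end Binomial

/-! ### The Bernstein statistic as a kernel on [0, 1]: bounds and exact integrals. -/

section Kernel

theorem sum_bw (n : ℕ) (x : ℝ) : ∑ k ∈ Finset.range (n + 1), bw n x k = 1 := by
  have := binomMoment_zero n x
  simpa [binomMoment, binomMean] using this

theorem T_of_mem {m k : ℕ} (x : ℝ) {y : ℝ} (hm : 0 < m) (hk : k < m)
    (hy : y ∈ Set.Ioc ((k : ℝ) / m) (((k : ℝ) + 1) / m)) : T m x y = m * bw (m - 1) x k := by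
  have hm' : (0 : ℝ) < m := by exact_mod_cast hm
  rw [T, Finset.sum_eq_single k]
  · rw [Set.indicator_of_mem hy, one_mul, bw]
  · intro j _ hjk
    rw [Set.indicator_of_notMem, zero_mul]
    rintro ⟨h1, h2⟩
    have h3 := h1.trans_le hy.2
    have h4 := hy.1.trans_le h2
    rw [div_lt_div_iff_of_pos_right hm'] at h3 h4
    norm_cast at h3 h4
    omega
  · intro h; exact absurd (Finset.mem_range.2 hk) h

theorem T_nonneg {x : ℝ} (hx : x ∈ Set.Ioo (0 : ℝ) 1) (m : ℕ) (y : ℝ) : 0 ≤ T m x y := by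
  refine mul_nonneg (Nat.cast_nonneg _) (Finset.sum_nonneg fun k _ => mul_nonneg ?_ ?_)
  · exact Set.indicator_nonneg (fun _ _ => zero_le_one) _
  · exact bw_nonneg hx (m - 1) k

theorem T_le {x : ℝ} (hx : x ∈ Set.Ioo (0 : ℝ) 1) (m : ℕ) (y : ℝ) : T m x y ≤ m := by
  rcases Nat.eq_zero_or_pos m with rfl | hm
  · simp [T]
  have h : ∑ k ∈ Finset.range m,
      (Set.Ioc ((k : ℝ) / m) (((k : ℝ) + 1) / m)).indicator (fun _ => (1 : ℝ)) y *
        (bernsteinPolynomial ℝ (m - 1) k).eval x ≤ 1 := by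
    have h1 := sum_bw (m - 1) x
    rw [Nat.sub_add_cancel hm] at h1
    refine le_of_le_of_eq ?_ h1
    refine Finset.sum_le_sum fun k _ => ?_
    refine mul_le_of_le_one_left (bw_nonneg hx (m - 1) k) ?_
    exact Set.indicator_apply_le' (fun _ => le_rfl) (fun _ => zero_le_one)
  exact mul_le_of_le_one_right (Nat.cast_nonneg _) h

theorem abs_T_le {x : ℝ} (hx : x ∈ Set.Ioo (0 : ℝ) 1) (m : ℕ) (y : ℝ) : |T m x y| ≤ m := by
  rw [abs_of_nonneg (T_nonneg hx m y)]; exact T_le hx m y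

@[fun_prop]
theorem measurable_T (m : ℕ) (x : ℝ) : Measurable (T m x) := by
  refine Measurable.const_mul (Finset.measurable_sum _ fun k _ => ?_) _
  exact (measurable_const.indicator measurableSet_Ioc).mul_const _

/-- The integral over `[0, 1]` of a function that agrees with `H k` on the `k`-th cell of the
`m`-grid. -/
theorem integral_cells {m : ℕ} (hm : 0 < m) {G : ℝ → ℝ} {H : ℕ → ℝ → ℝ}
    (hH : ∀ k, Continuous (H k))
    (hG : ∀ k < m, ∀ y ∈ Set.Ioc ((k : ℝ) / m) (((k : ℝ) + 1) / m), G y = H k y) :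
    ∫ y in (0 : ℝ)..1, G y =
      ∑ k ∈ Finset.range m, ∫ y in ((k : ℝ) / m)..(((k : ℝ) + 1) / m), H k y := by
  have hm' : (0 : ℝ) < m := by exact_mod_cast hm
  have hle : ∀ k : ℕ, (k : ℝ) / m ≤ ((k : ℝ) + 1) / m := fun k => by gcongr; linarith
  have hcast : ∀ k : ℕ, (((k + 1 : ℕ) : ℝ)) / m = ((k : ℝ) + 1) / m := fun k => by push_cast; rfl
  have h := intervalIntegral.sum_integral_adjacent_intervals (f := G) (μ := volume)
    (a := fun k : ℕ => (k : ℝ) / m) (n := m) ?_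
  · simp only [Nat.cast_zero, zero_div, div_self hm'.ne'] at h
    rw [← h]
    refine Finset.sum_congr rfl fun k hk => ?_
    rw [hcast, intervalIntegral.integral_of_le (hle k), intervalIntegral.integral_of_le (hle k)]
    exact setIntegral_congr_fun measurableSet_Ioc (hG k (Finset.mem_range.1 hk))
  · intro k hk
    rw [hcast, intervalIntegrable_iff_integrableOn_Ioc_of_le (hle k)]
    refine IntegrableOn.congr_fun (f := H k) ?_ (fun y hy => (hG k hk y hy).symm) measurableSet_Ioc
    exact ((hH k).intervalIntegrable _ _).1

/-- On cell k the antiderivative is evaluated at endpoints whose distances to x are (k - nx + (1 -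
x))/(n + 1) and (k - nx - x)/(n + 1). Both are shifts of the centred binomial count, and the moment
of order j + 1 cancels in the difference. -/
theorem integral_sub_pow_mul_T (n : ℕ) (x : ℝ) (j : ℕ) :
    ((n : ℝ) + 1) ^ j * ∫ y in (0 : ℝ)..1, (y - x) ^ j * T (n + 1) x y =
      (∑ i ∈ Finset.range (j + 1), binomMoment n x i *
        (((1 - x) ^ (j + 1 - i) - (-x) ^ (j + 1 - i)) * (j + 1).choose i)) / (j + 1) := by
  have hn : ((n : ℝ) + 1) ≠ 0 := by positivity
  have hj : ((j : ℝ) + 1) ≠ 0 := by positivity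
  rw [integral_cells (Nat.succ_pos n) (H := fun k y => (y - x) ^ j * (((n + 1 : ℕ) : ℝ) * bw n x k))
    (fun k => by fun_prop) (fun k hk y hy => by rw [T_of_mem x (Nat.succ_pos n) hk hy]; rfl)]
  have h1 : ∀ k : ℕ, ∫ y in ((k : ℝ) / (n + 1 : ℕ))..(((k : ℝ) + 1) / (n + 1 : ℕ)),
      (y - x) ^ j * (((n + 1 : ℕ) : ℝ) * bw n x k) =
      (bw n x k * ((k : ℝ) - n * x + (1 - x)) ^ (j + 1) -
        bw n x k * ((k : ℝ) - n * x + -x) ^ (j + 1)) / (((n : ℝ) + 1) ^ j * (j + 1)) := by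
    intro k
    rw [intervalIntegral.integral_mul_const,
      intervalIntegral.integral_comp_sub_right (fun y => y ^ j), integral_pow]
    have e1 : ((k : ℝ) + 1) / (n + 1 : ℕ) - x = ((k : ℝ) - n * x + (1 - x)) / (n + 1) := by
      push_cast; field_simp; ring
    have e2 : (k : ℝ) / (n + 1 : ℕ) - x = ((k : ℝ) - n * x + -x) / (n + 1) := by
      push_cast; field_simp; ring
    rw [e1, e2, div_pow, div_pow]
    push_cast
    field_simp
    ring
  simp only [h1]
  rw [← Finset.sum_div, Finset.sum_sub_distrib]
  have h2 := binomMean_shift n x (1 - x) (j + 1)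
  have h3 := binomMean_shift n x (-x) (j + 1)
  rw [binomMean, Finset.sum_range_succ] at h2 h3
  rw [Finset.sum_range_succ, Finset.sum_range_succ _ n, h2, h3, Finset.sum_range_succ _ (j + 1),
    Finset.sum_range_succ _ (j + 1), add_sub_add_comm, ← Finset.sum_sub_distrib]
  simp only [mul_sub, sub_mul, Nat.sub_self, pow_zero, sub_self, add_zero]
  field_simp

theorem integral_T (n : ℕ) (x : ℝ) : ∫ y in (0 : ℝ)..1, T (n + 1) x y = 1 := by
  have h := integral_sub_pow_mul_T n x 0
  simpa [binomMoment_zero] using h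

theorem integral_T_sq {m : ℕ} (hm : 0 < m) (x : ℝ) :
    ∫ y in (0 : ℝ)..1, T m x y ^ 2 = m * ∑ k ∈ Finset.range m, bw (m - 1) x k ^ 2 := by
  have hm' : (m : ℝ) ≠ 0 := by positivity
  rw [integral_cells hm (H := fun k _ => ((m : ℝ) * bw (m - 1) x k) ^ 2)
    (fun k => by fun_prop) (fun k hk y hy => by rw [T_of_mem x hm hk hy]), Finset.mul_sum]
  refine Finset.sum_congr rfl fun k _ => ?_
  rw [intervalIntegral.integral_const, smul_eq_mul]
  field_simp
  ring

/-- Cell k of the fine grid lies in cell ⌊k/2⌋ of the coarse one, so the product is constant on fine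
cells. -/
theorem integral_T_mul_T {N : ℕ} (hN : 0 < N) (x : ℝ) :
    ∫ y in (0 : ℝ)..1, T (2 * N) x y * T N x y =
      N * ∑ k ∈ Finset.range (2 * N), bw (2 * N - 1) x k * bw (N - 1) x (k / 2) := by
  have hm : 0 < 2 * N := by omega
  have hN' : (0 : ℝ) < N := by exact_mod_cast hN
  rw [integral_cells hm (H := fun k _ =>
    (((2 * N : ℕ) : ℝ) * bw (2 * N - 1) x k) * (N * bw (N - 1) x (k / 2)))
    (fun k => by fun_prop) (fun k hk y hy => ?_), Finset.mul_sum]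
  · refine Finset.sum_congr rfl fun k _ => ?_
    rw [intervalIntegral.integral_const, smul_eq_mul]
    push_cast
    field_simp
    ring
  · rw [T_of_mem x hm hk hy, T_of_mem x hN (by omega : k / 2 < N)]
    obtain ⟨h1, h2⟩ := hy
    push_cast at h1 h2
    have h3 : 2 * ((k / 2 : ℕ) : ℝ) ≤ k := by exact_mod_cast (by omega : 2 * (k / 2) ≤ k)
    have h4 : (k : ℝ) + 1 ≤ 2 * (((k / 2 : ℕ) : ℝ) + 1) := by
      exact_mod_cast (by omega : k + 1 ≤ 2 * (k / 2 + 1))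
    rw [div_lt_iff₀ (by positivity)] at h1
    rw [le_div_iff₀ (by positivity)] at h2
    constructor
    · rw [div_lt_iff₀ hN']; linarith
    · rw [le_div_iff₀ hN']; linarith

end Kernel

/-! ### Fourier inversion and Laplace's method for sums of products of binomial weights. -/

section LocalLimit

open Complex in
theorem integral_cexp_int (p : ℤ) :
    ∫ t in -Real.pi..Real.pi, cexp (p * t * I) = if p = 0 then 2 * (Real.pi : ℂ) else 0 := by
  split_ifs with h
  · simp [h]; ring
  · have hp : (p : ℂ) * I ≠ 0 := mul_ne_zero (by exact_mod_cast h) I_ne_zero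
    have h1 : ∀ t : ℝ, (p : ℂ) * t * I = p * I * t := fun t => by ring
    simp only [h1]
    rw [integral_exp_mul_complex hp]
    have h2 : cexp (p * I * (Real.pi : ℝ)) = cexp (p * I * ((-Real.pi : ℝ) : ℂ)) := by
      rw [Complex.exp_eq_exp_iff_exists_int]
      exact ⟨p, by push_cast; ring⟩
    rw [h2, sub_self, zero_div]

open Complex in
theorem integral_trigPolynomial {ι : Type*} (s : Finset ι) (c : ι → ℂ) (p : ι → ℤ) :
    ∫ t in -Real.pi..Real.pi, ∑ i ∈ s, c i * cexp (p i * t * I) =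
      2 * Real.pi * ∑ i ∈ s, if p i = 0 then c i else 0 := by
  rw [intervalIntegral.integral_finsetSum]
  · rw [Finset.mul_sum]
    refine Finset.sum_congr rfl fun i _ => ?_
    rw [intervalIntegral.integral_const_mul, integral_cexp_int]
    split_ifs <;> ring
  · intro i _
    exact Continuous.intervalIntegrable (by fun_prop) _ _

/-- The characteristic function of the Bernoulli law. -/
noncomputable def bernChar (x t : ℝ) : ℂ := (1 - x) + x * Complex.exp (t * Complex.I)

@[fun_prop]
theorem continuous_bernChar (x : ℝ) : Continuous (bernChar x) := by
  unfold bernChar; fun_prop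

theorem bernChar_zero (x : ℝ) : bernChar x 0 = 1 := by simp [bernChar]

theorem bernChar_pow (n : ℕ) (x t : ℝ) :
    bernChar x t ^ n =
      ∑ k ∈ Finset.range (n + 1), (bw n x k : ℂ) * Complex.exp (k * t * Complex.I) := by
  rw [bernChar, add_comm, add_pow]
  refine Finset.sum_congr rfl fun k _ => ?_
  rw [bw_eq, mul_pow, ← Complex.exp_nat_mul]
  push_cast
  rw [mul_assoc (k : ℂ)]
  ring

theorem norm_bernChar_sq (x t : ℝ) :
    ‖bernChar x t‖ ^ 2 = 1 - 2 * (x * (1 - x)) * (1 - Real.cos t) := by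
  have h : bernChar x t = ((1 - x + x * Real.cos t : ℝ) : ℂ) + (x * Real.sin t : ℝ) * Complex.I := by
    rw [bernChar, Complex.exp_mul_I]; push_cast; ring
  rw [h, ← Complex.normSq_eq_norm_sq, Complex.normSq_add_mul_I]
  linear_combination x ^ 2 * Real.sin_sq_add_cos_sq t

theorem norm_bernChar_le_one {x : ℝ} (hx : x ∈ Set.Ioo (0 : ℝ) 1) (t : ℝ) : ‖bernChar x t‖ ≤ 1 := by
  have h := norm_bernChar_sq x t
  have h1 : 0 ≤ 2 * (x * (1 - x)) * (1 - Real.cos t) :=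
    mul_nonneg (mul_nonneg zero_le_two (mul_nonneg hx.1.le (by linarith [hx.2])))
      (by linarith [Real.cos_le_one t])
  exact (sq_le_one_iff₀ (norm_nonneg _)).1 (by linarith)

/-- From 1 - cos t ≥ 2t²/π² on [-π, π] and 1 - u ≤ exp(-u). This is the Gaussian domination required
by Laplace's method. -/
theorem norm_bernChar_sq_le {x : ℝ} (hx : x ∈ Set.Ioo (0 : ℝ) 1) {t : ℝ} (ht : |t| ≤ Real.pi) :
    ‖bernChar x t‖ ^ 2 ≤ Real.exp (-(4 * (x * (1 - x)) / Real.pi ^ 2) * t ^ 2) := by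
  have hq : 0 < x * (1 - x) := mul_pos hx.1 (by linarith [hx.2])
  have h := Real.cos_le_one_sub_mul_cos_sq ht
  have h2 : -(4 * (x * (1 - x)) / Real.pi ^ 2) * t ^ 2 =
      -(2 * (x * (1 - x)) * (2 / Real.pi ^ 2 * t ^ 2)) := by ring
  have h3 := Real.add_one_le_exp (-(4 * (x * (1 - x)) / Real.pi ^ 2) * t ^ 2)
  rw [norm_bernChar_sq]
  nlinarith

theorem tendsto_cexp_quotient (l : ℝ) :
    Tendsto (fun u : ℝ => (Complex.exp ((l * u : ℝ) * Complex.I) - 1 - l * u * Complex.I) / u ^ 2)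
      (𝓝[≠] 0) (𝓝 (-(l : ℂ) ^ 2 / 2)) := by
  have h0 := (Complex.exp_sub_sum_range_succ_isLittleO_pow 2)
  have h1 : Tendsto (fun u : ℝ => ((l * u : ℝ) : ℂ) * Complex.I) (𝓝 0) (𝓝 0) := by
    have : Continuous (fun u : ℝ => ((l * u : ℝ) : ℂ) * Complex.I) := by fun_prop
    simpa using this.tendsto 0
  have hO : ((fun z : ℂ => z ^ 2) ∘ fun u : ℝ => ((l * u : ℝ) : ℂ) * Complex.I)
      =O[𝓝 0] fun u : ℝ => (u : ℂ) ^ 2 := by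
    refine IsBigO.of_bound (|l| ^ 2) (Eventually.of_forall fun u => ?_)
    simp [mul_pow]
  have h2 := (h0.comp_tendsto h1).trans_isBigO hO
  have h3 := (h2.tendsto_div_nhds_zero.mono_left (nhdsWithin_le_nhds (s := {0}ᶜ))).add_const
    (-(l : ℂ) ^ 2 / 2)
  rw [zero_add] at h3
  refine h3.congr' ?_
  filter_upwards [self_mem_nhdsWithin] with u hu
  have hu' : (u : ℂ) ≠ 0 := by exact_mod_cast hu
  simp only [Function.comp, Finset.sum_range_succ, Finset.sum_range_zero]
  push_cast
  field_simp
  simp [Nat.factorial]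
  ring

/-- Laplace's method for powers of a characteristic function. -/
theorem tendsto_sqrt_mul_integral_pow {g h : ℝ → ℂ} (hg : Continuous g) (hh : Continuous h)
    {c σ : ℝ} (hc : 0 < c) (hg0 : g 0 = 1)
    (hbound : ∀ t, |t| ≤ Real.pi → ‖g t‖ ≤ Real.exp (-c * t ^ 2))
    (hquad : Tendsto (fun u : ℝ => (g u - 1) / u ^ 2) (𝓝[≠] 0) (𝓝 (-(σ : ℂ)))) :
    Tendsto (fun N : ℕ => (√(N : ℝ) : ℂ) * ∫ t in -Real.pi..Real.pi, g t ^ N * h t) atTop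
      (𝓝 (h 0 * √(Real.pi / σ))) := by
  obtain ⟨H, hH⟩ := (isCompact_Icc (a := -Real.pi) (b := Real.pi)).exists_bound_of_continuousOn
    hh.continuousOn
  have hH0 : 0 ≤ H := (norm_nonneg _).trans (hH 0 ⟨by linarith [Real.pi_pos], Real.pi_pos.le⟩)
  -- Substituting t = s/√N absorbs the factor √N. The integrand is dominated by H exp(-cs²) and
  -- converges pointwise to exp(-σs²) h(0).
  set F : ℕ → ℝ → ℂ := fun N => (Set.Ioc (-Real.pi * √N) (Real.pi * √N)).indicator
    fun s => g (s / √N) ^ N * h (s / √N) with hF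
  have hsub : ∀ᶠ N : ℕ in atTop, ∫ s, F N s =
      (√(N : ℝ) : ℂ) * ∫ t in -Real.pi..Real.pi, g t ^ N * h t := by
    filter_upwards [eventually_ge_atTop 1] with N hN
    have hN' : 0 < √(N : ℝ) := Real.sqrt_pos.2 (by exact_mod_cast hN)
    rw [hF, integral_indicator measurableSet_Ioc, ← intervalIntegral.integral_of_le
      (by nlinarith [Real.pi_pos])]
    rw [intervalIntegral.integral_comp_div (fun t => g t ^ N * h t) hN'.ne',
      mul_div_cancel_right₀ _ hN'.ne', mul_div_cancel_right₀ _ hN'.ne', Complex.real_smul]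
  have hlim : ∫ s : ℝ, Complex.exp (-σ * s ^ 2 : ℝ) * h 0 = h 0 * √(Real.pi / σ) := by
    rw [integral_mul_const, ← integral_gaussian, mul_comm]
    congr 1
    rw [← integral_complex_ofReal]
    simp only [Complex.ofReal_exp]
  rw [← hlim]
  refine (tendsto_integral_of_dominated_convergence (F := F)
    (fun s => Real.exp (-c * s ^ 2) * H) ?_ ?_ ?_ ?_).congr' hsub
  · intro N
    refine (Continuous.aestronglyMeasurable ?_).indicator measurableSet_Ioc
    fun_prop
  · exact (integrable_exp_neg_mul_sq hc).mul_const H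
  · intro N
    refine Eventually.of_forall fun s => ?_
    rw [hF]
    by_cases hs : s ∈ Set.Ioc (-Real.pi * √N) (Real.pi * √N)
    · simp only [Set.indicator_of_mem hs]
      rcases Nat.eq_zero_or_pos N with rfl | hN
      · simp at hs
      have hN' : 0 < √(N : ℝ) := Real.sqrt_pos.2 (by exact_mod_cast hN)
      have h1 : |s / √N| ≤ Real.pi := by
        rw [abs_le, le_div_iff₀ hN', div_le_iff₀ hN']
        exact ⟨hs.1.le, hs.2⟩
      rw [norm_mul, norm_pow]
      refine mul_le_mul ?_ (hH _ (abs_le.1 h1)) (norm_nonneg _) (Real.exp_pos _).le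
      refine (pow_le_pow_left₀ (norm_nonneg _) (hbound _ h1) N).trans (le_of_eq ?_)
      rw [← Real.exp_nat_mul, div_pow, Real.sq_sqrt (Nat.cast_nonneg N)]
      congr 1
      field_simp
    · simp only [Set.indicator_of_notMem hs, norm_zero]
      positivity
  · refine Eventually.of_forall fun s => ?_
    have hsq : Tendsto (fun N : ℕ => √(N : ℝ)) atTop atTop :=
      Real.tendsto_sqrt_atTop.comp tendsto_natCast_atTop_atTop
    have hu : Tendsto (fun N : ℕ => s / √(N : ℝ)) atTop (𝓝 0) := hsq.const_div_atTop s
    have hmem : ∀ᶠ N : ℕ in atTop, s ∈ Set.Ioc (-Real.pi * √N) (Real.pi * √N) := by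
      filter_upwards [(hu.eventually (Ioo_mem_nhds (by linarith [Real.pi_pos] : -Real.pi < 0)
        Real.pi_pos)), eventually_ge_atTop 1] with N h1 hN
      have hN' : 0 < √(N : ℝ) := Real.sqrt_pos.2 (by exact_mod_cast hN)
      rw [lt_div_iff₀ hN', div_lt_iff₀ hN'] at h1
      exact ⟨h1.1, h1.2.le⟩
    have hpow : Tendsto (fun N : ℕ => g (s / √N) ^ N) atTop
        (𝓝 (Complex.exp (-σ * s ^ 2 : ℝ))) := by
      rcases eq_or_ne s 0 with rfl | hs
      · simp [hg0]
      have h1 : Tendsto (fun N : ℕ => (N : ℂ) * (g (s / √N) - 1)) atTop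
          (𝓝 ((-σ * s ^ 2 : ℝ) : ℂ)) := by
        have h2 : Tendsto (fun N : ℕ => s / √(N : ℝ)) atTop (𝓝[≠] 0) := by
          refine tendsto_nhdsWithin_iff.2 ⟨hu, ?_⟩
          filter_upwards [eventually_ge_atTop 1] with N hN
          have hN' : 0 < √(N : ℝ) := Real.sqrt_pos.2 (by exact_mod_cast hN)
          exact div_ne_zero hs hN'.ne'
        have h3 := (hquad.comp h2).mul_const ((s : ℂ) ^ 2)
        push_cast
        refine h3.congr' ?_
        filter_upwards [eventually_ge_atTop 1] with N hN
        have hN' : ((√(N : ℝ) : ℝ) : ℂ) ≠ 0 := by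
          exact_mod_cast (Real.sqrt_pos.2 (by exact_mod_cast hN : (0 : ℝ) < N)).ne'
        have hs' : (s : ℂ) ≠ 0 := by exact_mod_cast hs
        have h4 : ((√(N : ℝ) : ℝ) : ℂ) ^ 2 = N := by
          rw [← Complex.ofReal_pow, Real.sq_sqrt (Nat.cast_nonneg N)]; simp
        simp only [Function.comp]
        push_cast
        rw [← h4]
        field_simp
      have h5 := Complex.tendsto_one_add_pow_exp_of_tendsto h1
      simpa using h5
    have h6 := hpow.mul ((hh.tendsto 0).comp hu)
    refine h6.congr' ?_
    filter_upwards [hmem] with N hN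
    simp only [hF, Set.indicator_of_mem hN, Function.comp]

/-- This is the characteristic function of the difference of two independent Bernoulli variables;
the mean is 0 and half the variance is x(1 - x). -/
theorem tendsto_bernChar_quotient (x : ℝ) :
    Tendsto (fun u : ℝ => (bernChar x u * bernChar x (-u) - 1) / u ^ 2) (𝓝[≠] 0)
      (𝓝 (-((x * (1 - x) : ℝ) : ℂ))) := by
  have h1 := tendsto_cexp_quotient 1
  have h2 := tendsto_cexp_quotient (-1)
  have hu : Tendsto (fun u : ℝ => (u : ℂ)) (𝓝[≠] 0) (𝓝 0) := by
    have : Continuous (fun u : ℝ => (u : ℂ)) := by fun_prop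
    simpa using (this.tendsto 0).mono_left nhdsWithin_le_nhds
  -- Writing exp(ilu) - 1 = u(il + u q_l(u)), with q_l the quotient of `tendsto_cexp_quotient`,
  -- makes the target a polynomial in u, q₁ and q₋₁.
  have h3 := ((h1.add h2).const_mul (x : ℂ)).add
    ((((h1.mul hu).const_add Complex.I).mul ((h2.mul hu).const_add (-Complex.I))).const_mul
      ((x : ℂ) ^ 2))
  have e : (x : ℂ) * (-((1 : ℝ) : ℂ) ^ 2 / 2 + -((-1 : ℝ) : ℂ) ^ 2 / 2) +
      x ^ 2 * ((Complex.I + -((1 : ℝ) : ℂ) ^ 2 / 2 * 0) *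
        (-Complex.I + -((-1 : ℝ) : ℂ) ^ 2 / 2 * 0)) = -((x * (1 - x) : ℝ) : ℂ) := by
    push_cast
    linear_combination (-(x : ℂ) ^ 2) * Complex.I_sq
  rw [e] at h3
  refine h3.congr' ?_
  filter_upwards [self_mem_nhdsWithin] with u hu
  have hu' : (u : ℂ) ≠ 0 := by exact_mod_cast hu
  simp only [bernChar]
  push_cast
  field_simp
  ring

/-- Here the variable is B₁ + B₂ - 2B₃ with independent Bernoulli terms: mean 0 and variance (1 + 1
+ 4)x(1 - x), half of which is the limit constant. -/
theorem tendsto_bernChar_sq_mul_quotient (x : ℝ) :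
    Tendsto (fun u : ℝ => (bernChar x u ^ 2 * bernChar x (-2 * u) - 1) / u ^ 2) (𝓝[≠] 0)
      (𝓝 (-((3 * (x * (1 - x)) : ℝ) : ℂ))) := by
  have h1 := tendsto_cexp_quotient 1
  have h2 := tendsto_cexp_quotient (-2)
  have hu : Tendsto (fun u : ℝ => (u : ℂ)) (𝓝[≠] 0) (𝓝 0) := by
    have : Continuous (fun u : ℝ => (u : ℂ)) := by fun_prop
    simpa using (this.tendsto 0).mono_left nhdsWithin_le_nhds
  have hA := (h1.mul hu).const_add Complex.I
  have hB := (h2.mul hu).const_add (-2 * Complex.I)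
  have h3 := (((((h1.const_mul 2).add h2).const_mul (x : ℂ)).add
    ((hA.pow 2).const_mul ((x : ℂ) ^ 2))).add ((hA.mul hB).const_mul (2 * (x : ℂ) ^ 2))).add
    ((((hA.pow 2).mul hB).mul hu).const_mul ((x : ℂ) ^ 3))
  have e : (x : ℂ) * (2 * (-((1 : ℝ) : ℂ) ^ 2 / 2) + -((-2 : ℝ) : ℂ) ^ 2 / 2) +
      x ^ 2 * (Complex.I + -((1 : ℝ) : ℂ) ^ 2 / 2 * 0) ^ 2 +
      2 * x ^ 2 * ((Complex.I + -((1 : ℝ) : ℂ) ^ 2 / 2 * 0) *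
        (-2 * Complex.I + -((-2 : ℝ) : ℂ) ^ 2 / 2 * 0)) +
      x ^ 3 * ((Complex.I + -((1 : ℝ) : ℂ) ^ 2 / 2 * 0) ^ 2 *
        (-2 * Complex.I + -((-2 : ℝ) : ℂ) ^ 2 / 2 * 0) * 0) =
        -((3 * (x * (1 - x)) : ℝ) : ℂ) := by
    push_cast
    linear_combination (-3 * (x : ℂ) ^ 2) * Complex.I_sq
  rw [e] at h3
  refine h3.congr' ?_
  filter_upwards [self_mem_nhdsWithin] with u hu
  have hu' : (u : ℂ) ≠ 0 := by exact_mod_cast hu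
  simp only [bernChar]
  push_cast
  field_simp
  ring

theorem integral_bernChar_mul (n : ℕ) (x : ℝ) :
    ∫ t in -Real.pi..Real.pi, (bernChar x t * bernChar x (-t)) ^ n =
      ((2 * Real.pi * ∑ k ∈ Finset.range (n + 1), bw n x k ^ 2 : ℝ) : ℂ) := by
  have h1 : ∀ t : ℝ, (bernChar x t * bernChar x (-t)) ^ n =
      ∑ i ∈ Finset.range (n + 1) ×ˢ Finset.range (n + 1),
        ((bw n x i.1 : ℂ) * bw n x i.2) *
          Complex.exp (((i.1 : ℤ) - (i.2 : ℤ) : ℤ) * t * Complex.I) := by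
    intro t
    rw [mul_pow, bernChar_pow, bernChar_pow, Finset.sum_mul_sum, Finset.sum_product]
    refine Finset.sum_congr rfl fun k _ => Finset.sum_congr rfl fun j _ => ?_
    rw [mul_mul_mul_comm, ← Complex.exp_add]
    congr 2
    push_cast
    ring
  simp only [h1]
  rw [integral_trigPolynomial, Finset.sum_product]
  push_cast
  congr 1
  refine Finset.sum_congr rfl fun k hk => ?_
  rw [Finset.sum_eq_single k]
  · simp [sq]
  · intro j _ hj
    rw [if_neg]
    omega
  · intro h; exact absurd hk h

/-- The factor 1 + exp(-it) supplies a remainder i ∈ {0, 1}: the zero-frequency condition k = 2j + i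
is then exactly j = ⌊k/2⌋, i = k mod 2. The extra characteristic function raises the power 2n to 2n
+ 1. -/
theorem integral_bernChar_sq_mul (n : ℕ) (x : ℝ) :
    ∫ t in -Real.pi..Real.pi, (bernChar x t ^ 2 * bernChar x (-2 * t)) ^ n *
        (bernChar x t * (1 + Complex.exp (-t * Complex.I))) =
      ((2 * Real.pi * ∑ k ∈ Finset.range (2 * n + 2), bw (2 * n + 1) x k * bw n x (k / 2) : ℝ) :
        ℂ) := by
  have h1 : ∀ t : ℝ, (bernChar x t ^ 2 * bernChar x (-2 * t)) ^ n *
      (bernChar x t * (1 + Complex.exp (-t * Complex.I))) =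
      ∑ i ∈ (Finset.range (2 * n + 2) ×ˢ Finset.range (n + 1)) ×ˢ Finset.range 2,
        ((bw (2 * n + 1) x i.1.1 : ℂ) * bw n x i.1.2) *
          Complex.exp (((i.1.1 : ℤ) - 2 * (i.1.2 : ℤ) - (i.2 : ℤ) : ℤ) * t * Complex.I) := by
    intro t
    have e : (bernChar x t ^ 2 * bernChar x (-2 * t)) ^ n *
      (bernChar x t * (1 + Complex.exp (-t * Complex.I))) = bernChar x t ^ (2 * n + 1) *
        bernChar x (-2 * t) ^ n * (1 + Complex.exp (-t * Complex.I)) := by ring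
    rw [e, bernChar_pow, bernChar_pow, Finset.sum_mul_sum, Finset.sum_product,
      Finset.sum_product, Finset.sum_mul]
    refine Finset.sum_congr rfl fun k _ => ?_
    rw [Finset.sum_mul]
    refine Finset.sum_congr rfl fun j _ => ?_
    rw [Finset.sum_range_succ, Finset.sum_range_one, mul_mul_mul_comm, ← Complex.exp_add,
      mul_assoc, mul_add, ← Complex.exp_add, mul_add]
    congr 3 <;> push_cast <;> ring_nf
  simp only [h1]
  rw [integral_trigPolynomial, Finset.sum_product, Finset.sum_product]
  push_cast
  congr 1
  refine Finset.sum_congr rfl fun k hk => ?_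
  have hk' := Finset.mem_range.1 hk
  rw [Finset.sum_eq_single (k / 2), Finset.sum_eq_single (k % 2)]
  · rw [if_pos]
    omega
  · intro j _ hj
    rw [if_neg]
    omega
  · intro h
    exact absurd (Finset.mem_range.2 (Nat.mod_lt _ two_pos)) h
  · intro j _ hj
    refine Finset.sum_eq_zero fun i hi => ?_
    have := Finset.mem_range.1 hi
    rw [if_neg]
    omega
  · intro h
    exact absurd (Finset.mem_range.2 (by omega)) h

/-- Collision probability of two independent binomial variables. -/
theorem tendsto_sqrt_mul_sum_bw_sq {x : ℝ} (hx : x ∈ Set.Ioo (0 : ℝ) 1) :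
    Tendsto (fun n : ℕ => √(n : ℝ) * ∑ k ∈ Finset.range (n + 1), bw n x k ^ 2) atTop
      (𝓝 (psi x)) := by
  have hq : 0 < x * (1 - x) := mul_pos hx.1 (by linarith [hx.2])
  have h := tendsto_sqrt_mul_integral_pow (g := fun t => bernChar x t * bernChar x (-t))
    (h := fun _ => 1) (c := 4 * (x * (1 - x)) / Real.pi ^ 2) (σ := x * (1 - x))
    (by fun_prop) (by fun_prop) (by positivity) (by simp [bernChar_zero])
    (fun t ht => ?_) (tendsto_bernChar_quotient x)
  · simp only [mul_one, one_mul, integral_bernChar_mul] at h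
    norm_cast at h
    have h1 := (Complex.continuous_re.tendsto _).comp h
    simp only [Function.comp_def, Complex.ofReal_re] at h1
    have h2 := h1.const_mul (2 * Real.pi)⁻¹
    have e : (2 * Real.pi)⁻¹ * √(Real.pi / (x * (1 - x))) = psi x := by
      have hp := Real.pi_pos
      have e1 : 4 * Real.pi * x * (1 - x) = (2 * Real.pi) ^ 2 / (Real.pi / (x * (1 - x))) := by
        have : x ≠ 0 := hx.1.ne'
        have : 1 - x ≠ 0 := by linarith [hx.2]
        field_simp; ring
      rw [psi, e1, Real.sqrt_div (sq_nonneg (2 * Real.pi)), Real.sqrt_sq (by positivity), inv_div]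
      ring
    rw [e] at h2
    refine h2.congr fun n => ?_
    have hp := Real.pi_pos.ne'
    field_simp
  · rw [norm_mul]
    have h1 : ‖bernChar x (-t)‖ = ‖bernChar x t‖ := by
      rw [← sq_eq_sq₀ (norm_nonneg _) (norm_nonneg _), norm_bernChar_sq, norm_bernChar_sq,
        Real.cos_neg]
    rw [h1, ← sq]
    exact norm_bernChar_sq_le hx ht

/-- Laplace's method with h(0) = 2 and σ = 3x(1 - x). The √2 in the limit reflects normalization by
the square root of n, not of the fine order 2(n + 1). -/
theorem tendsto_sqrt_mul_sum_bw_mul_bw {x : ℝ} (hx : x ∈ Set.Ioo (0 : ℝ) 1) :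
    Tendsto (fun n : ℕ => √(n : ℝ) *
      ∑ k ∈ Finset.range (2 * n + 2), bw (2 * n + 1) x k * bw n x (k / 2)) atTop
      (𝓝 (√2 * √(2 / 3) * psi x)) := by
  have hq : 0 < x * (1 - x) := mul_pos hx.1 (by linarith [hx.2])
  have h := tendsto_sqrt_mul_integral_pow
    (g := fun t => bernChar x t ^ 2 * bernChar x (-2 * t))
    (h := fun t => bernChar x t * (1 + Complex.exp (-t * Complex.I)))
    (c := 4 * (x * (1 - x)) / Real.pi ^ 2) (σ := 3 * (x * (1 - x)))
    (by fun_prop) (by fun_prop) (by positivity) (by simp [bernChar_zero])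
    (fun t ht => ?_) (tendsto_bernChar_sq_mul_quotient x)
  · simp only [integral_bernChar_sq_mul, bernChar_zero] at h
    have e0 : (1 : ℂ) * (1 + Complex.exp (-(0 : ℝ) * Complex.I)) *
        (√(Real.pi / (3 * (x * (1 - x)))) : ℝ) =
        ((2 * √(Real.pi / (3 * (x * (1 - x)))) : ℝ) : ℂ) := by
      push_cast
      simp only [neg_zero, zero_mul, Complex.exp_zero]
      ring
    rw [e0] at h
    have h1 := (Complex.continuous_re.tendsto _).comp h
    simp only [Function.comp_def, ← Complex.ofReal_mul, Complex.ofReal_re] at h1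
    have h2 := h1.const_mul (2 * Real.pi)⁻¹
    have e : (2 * Real.pi)⁻¹ * (2 * √(Real.pi / (3 * (x * (1 - x))))) =
        √2 * √(2 / 3) * psi x := by
      have hp := Real.pi_pos
      have e1 : (2 : ℝ) * (2 / 3) = 4 * Real.pi * x * (1 - x) *
          ((Real.pi / (3 * (x * (1 - x)))) / Real.pi ^ 2) := by
        have : x ≠ 0 := hx.1.ne'
        have : 1 - x ≠ 0 := by linarith [hx.2]
        field_simp
        norm_num
      have hpos : 0 < 4 * Real.pi * x * (1 - x) := by
        rw [mul_assoc]; positivity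
      have hne : √(4 * Real.pi * x * (1 - x)) ≠ 0 := (Real.sqrt_pos.2 hpos).ne'
      rw [psi, ← Real.sqrt_mul zero_le_two, e1, Real.sqrt_mul hpos.le,
        Real.sqrt_div (by positivity : 0 ≤ Real.pi / (3 * (x * (1 - x)))),
        Real.sqrt_sq hp.le, mul_comm √(4 * Real.pi * x * (1 - x)), mul_assoc, mul_inv_cancel₀ hne]
      field_simp
    rw [e] at h2
    refine h2.congr fun n => ?_
    have hp := Real.pi_pos.ne'
    field_simp
  · rw [norm_mul, norm_pow]
    exact (mul_le_of_le_one_right (by positivity) (norm_bernChar_le_one hx _)).trans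
      (norm_bernChar_sq_le hx ht)

end LocalLimit

/-! ### Moments of the kernel about x, and their limits at scale m⁻². -/

section Moments

/-- Moments about `x` of the uniform law on `[0, 1]`. -/
noncomputable def unifMoment (x : ℝ) (j : ℕ) : ℝ :=
  ((1 - x) ^ (j + 1) - (-x) ^ (j + 1)) / (j + 1)

theorem integral_sub_mul_T (n : ℕ) (x : ℝ) :
    ((n : ℝ) + 1) ^ 1 * ∫ y in (0 : ℝ)..1, (y - x) ^ 1 * T (n + 1) x y = 1 / 2 - x := by
  rw [integral_sub_pow_mul_T]
  simp [Finset.sum_range_succ, binomMoment_zero, binomMoment_one]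
  ring

theorem integral_sub_sq_mul_T (n : ℕ) (x : ℝ) :
    ((n : ℝ) + 1) ^ 2 * ∫ y in (0 : ℝ)..1, (y - x) ^ 2 * T (n + 1) x y =
      n * (x * (1 - x)) + (1 / 3 - x * (1 - x)) := by
  rw [integral_sub_pow_mul_T]
  simp [Finset.sum_range_succ, binomMoment_zero, binomMoment_one, binomMoment_two, Nat.choose]
  ring

theorem integral_sub_cube_mul_T (n : ℕ) (x : ℝ) :
    ((n : ℝ) + 1) ^ 3 * ∫ y in (0 : ℝ)..1, (y - x) ^ 3 * T (n + 1) x y =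
      n * (5 / 2 * (x * (1 - x)) * (1 - 2 * x)) + unifMoment x 3 := by
  rw [integral_sub_pow_mul_T]
  simp [Finset.sum_range_succ, binomMoment_zero, binomMoment_one, binomMoment_two,
    binomMoment_three, Nat.choose, unifMoment]
  ring

theorem integral_sub_pow_four_mul_T (n : ℕ) (x : ℝ) :
    ((n : ℝ) + 1) ^ 4 * ∫ y in (0 : ℝ)..1, (y - x) ^ 4 * T (n + 1) x y =
      binomMoment n x 4 + 4 * binomMoment n x 3 * unifMoment x 1 +
        6 * binomMoment n x 2 * unifMoment x 2 + unifMoment x 4 := by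
  rw [integral_sub_pow_mul_T]
  simp [Finset.sum_range_succ, binomMoment_zero, binomMoment_one, Nat.choose, unifMoment]
  ring

theorem integral_sub_pow_six_mul_T (n : ℕ) (x : ℝ) :
    ((n : ℝ) + 1) ^ 6 * ∫ y in (0 : ℝ)..1, (y - x) ^ 6 * T (n + 1) x y =
      binomMoment n x 6 + 6 * binomMoment n x 5 * unifMoment x 1 +
        15 * binomMoment n x 4 * unifMoment x 2 + 20 * binomMoment n x 3 * unifMoment x 3 +
        15 * binomMoment n x 2 * unifMoment x 4 + unifMoment x 6 := by
  rw [integral_sub_pow_mul_T]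
  simp [Finset.sum_range_succ, binomMoment_zero, binomMoment_one, Nat.choose, unifMoment]
  ring

theorem tendsto_inv_add_one : Tendsto (fun n : ℕ => ((n : ℝ) + 1)⁻¹) atTop (𝓝 0) := by
  simpa using tendsto_one_div_add_atTop_nhds_zero_nat (𝕜 := ℝ)

theorem tendsto_moment_three (x : ℝ) :
    Tendsto (fun n : ℕ => ((n : ℝ) + 1) ^ 2 * ∫ y in (0 : ℝ)..1, (y - x) ^ 3 * T (n + 1) x y)
      atTop (𝓝 (5 / 2 * (x * (1 - x)) * (1 - 2 * x))) := by
  have h : Tendsto (fun n : ℕ => 5 / 2 * (x * (1 - x)) * (1 - 2 * x) * (1 - ((n : ℝ) + 1)⁻¹) +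
      unifMoment x 3 * ((n : ℝ) + 1)⁻¹) atTop
      (𝓝 (5 / 2 * (x * (1 - x)) * (1 - 2 * x) * (1 - 0) + unifMoment x 3 * 0)) :=
    ((tendsto_inv_add_one.const_sub 1).const_mul _).add (tendsto_inv_add_one.const_mul _)
  simp only [sub_zero, mul_one, mul_zero, add_zero] at h
  refine h.congr fun n => ?_
  have hn : ((n : ℝ) + 1) ≠ 0 := by positivity
  have h1 := integral_sub_cube_mul_T n x
  rw [eq_comm, ← mul_right_inj' hn, ← mul_assoc, ← pow_succ', h1]
  field_simp
  ring

theorem tendsto_moment_four (x : ℝ) :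
    Tendsto (fun n : ℕ => ((n : ℝ) + 1) ^ 2 * ∫ y in (0 : ℝ)..1, (y - x) ^ 4 * T (n + 1) x y)
      atTop (𝓝 (3 * (x * (1 - x)) ^ 2)) := by
  have hi := tendsto_inv_add_one
  have h := (((hi.const_sub 1).pow 2).const_mul (3 * (x * (1 - x)) ^ 2)).add
    (((hi.mul (hi.const_sub 1)).const_mul ((x * (1 - x)) * (1 - 6 * (x * (1 - x))) +
      4 * ((x * (1 - x)) * (1 - 2 * x)) * unifMoment x 1 + 6 * (x * (1 - x)) * unifMoment x 2)).add
    ((hi.pow 2).const_mul (unifMoment x 4)))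
  simp only [sub_zero, mul_one, mul_zero, add_zero, one_pow,
    zero_pow two_ne_zero] at h
  refine h.congr fun n => ?_
  have hn : ((n : ℝ) + 1) ≠ 0 := by positivity
  have h1 := integral_sub_pow_four_mul_T n x
  have hn2 : ((n : ℝ) + 1) ^ 2 ≠ 0 := by positivity
  rw [eq_comm, ← mul_right_inj' hn2, ← mul_assoc, ← pow_add, h1, binomMoment_four,
    binomMoment_three, binomMoment_two]
  field_simp
  ring

/-- The sixth binomial central moment is O(n³), so the kernel moment is O(m⁻³). It controls the part
of the Taylor remainder away from x. -/
theorem tendsto_moment_six (x : ℝ) :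
    Tendsto (fun n : ℕ => ((n : ℝ) + 1) ^ 2 * ∫ y in (0 : ℝ)..1, (y - x) ^ 6 * T (n + 1) x y)
      atTop (𝓝 0) := by
  have hi := tendsto_inv_add_one
  have hc := hi.const_sub 1
  set q := x * (1 - x) with hq
  have h := ((hi.mul (hc.pow 3)).const_mul (15 * q ^ 3)).add
    ((((hi.pow 2).mul (hc.pow 2)).const_mul
      (q ^ 2 * (15 * (1 - 6 * q) + 10 * (1 - 4 * q)) + 6 * (10 * q ^ 2 * (1 - 2 * x)) *
        unifMoment x 1 + 15 * (3 * q ^ 2) * unifMoment x 2)).add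
    ((((hi.pow 3).mul hc).const_mul
      (q * (1 - 30 * q + 120 * q ^ 2) + 6 * (q * (1 - 2 * x) * (1 - 12 * q)) * unifMoment x 1 +
        15 * (q * (1 - 6 * q)) * unifMoment x 2 + 20 * (q * (1 - 2 * x)) * unifMoment x 3 +
        15 * q * unifMoment x 4)).add ((hi.pow 4).const_mul (unifMoment x 6))))
  have e : ∀ a b c d : ℝ, a * (0 * (1 - 0) ^ 3) + (b * (0 ^ 2 * (1 - 0) ^ 2) +
      (c * (0 ^ 3 * (1 - 0)) + d * 0 ^ 4)) = 0 := fun a b c d => by ring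
  rw [e] at h
  refine h.congr fun n => ?_
  have hn : ((n : ℝ) + 1) ≠ 0 := by positivity
  have h1 := integral_sub_pow_six_mul_T n x
  have hn4 : ((n : ℝ) + 1) ^ 4 ≠ 0 := by positivity
  rw [eq_comm, ← mul_right_inj' hn4, ← mul_assoc, ← pow_add, h1, binomMoment_six,
    binomMoment_five, binomMoment_four, binomMoment_three, binomMoment_two, ← hq]
  field_simp
  ring

end Moments

/-! ### Mean and variance of one bias-reduced observation. -/

section Expectations

/-- Products of a continuous function on `[0, 1]` with a bounded measurable one are integrable. -/
theorem intervalIntegrable_mul_bdd {g B : ℝ → ℝ} (hg : ContinuousOn g (Set.Icc 0 1))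
    (hB : Measurable B) {C : ℝ} (hC : ∀ y, |B y| ≤ C) :
    IntervalIntegrable (fun y => g y * B y) volume 0 1 := by
  rw [intervalIntegrable_iff_integrableOn_Ioc_of_le zero_le_one]
  refine Integrable.mul_bdd (c := C) ((hg.integrableOn_Icc).mono_set Set.Ioc_subset_Icc_self)
    hB.aestronglyMeasurable (Eventually.of_forall hC)

/-- A remainder of order `o((y - x)^p)`, `p` even, is controlled by even powers on `[0, 1]`. -/
theorem exists_remainder_bound {R : ℝ → ℝ} {x : ℝ} {p : ℕ} (hp : Even p)
    (hR : ContinuousOn R (Set.Icc 0 1))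
    (ho : R =o[𝓝[Set.Icc 0 1] x] fun y => (y - x) ^ p) {ε : ℝ} (hε : 0 < ε) :
    ∃ C, 0 ≤ C ∧ ∀ y ∈ Set.Icc (0 : ℝ) 1, |R y| ≤ ε * (y - x) ^ p + C * (y - x) ^ (p + 2) := by
  obtain ⟨K, hK⟩ := (isCompact_Icc (a := (0 : ℝ)) (b := 1)).exists_bound_of_continuousOn hR
  have h1 := ho.def hε
  rw [eventually_nhdsWithin_iff, Metric.eventually_nhds_iff] at h1
  obtain ⟨δ, hδ, h2⟩ := h1
  have hp2 : Even (p + 2) := hp.add even_two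
  have hK0 : 0 ≤ K := (norm_nonneg _).trans (hK 0 ⟨le_rfl, zero_le_one⟩)
  -- Outside the δ-ball the global bound K is at most K(|y - x|/δ)^(p+2).
  refine ⟨K / δ ^ (p + 2), by positivity, fun y hy => ?_⟩
  have hpos1 := hp.pow_nonneg (y - x)
  have hpos2 := hp2.pow_nonneg (y - x)
  rcases lt_or_ge (dist y x) δ with h | h
  · have := h2 h hy
    rw [Real.norm_eq_abs, Real.norm_eq_abs, abs_of_nonneg hpos1] at this
    have : 0 ≤ K / δ ^ (p + 2) * (y - x) ^ (p + 2) := by positivity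
    linarith
  · have h3 : δ ^ (p + 2) ≤ (y - x) ^ (p + 2) := by
      rw [← hp2.pow_abs (y - x)]
      exact pow_le_pow_left₀ hδ.le h _
    have h4 : K ≤ K / δ ^ (p + 2) * (y - x) ^ (p + 2) := by
      rw [div_mul_eq_mul_div, le_div_iff₀ (by positivity)]
      exact mul_le_mul_of_nonneg_left h3 hK0
    have h5 := hK y hy
    rw [Real.norm_eq_abs] at h5
    have : 0 ≤ ε * (y - x) ^ p := by positivity
    linarith

/-- If `|u| ≤ ε v + C w` for all `ε` with `v` bounded and `w → 0`, then `u → 0`. -/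
theorem tendsto_zero_of_le_mul_add {ι : Type*} {l : Filter ι} {u v w : ι → ℝ} {v₀ : ℝ}
    (hv : Tendsto v l (𝓝 v₀)) (hw : Tendsto w l (𝓝 0))
    (h : ∀ ε > 0, ∃ C, ∀ᶠ i in l, |u i| ≤ ε * v i + C * w i) : Tendsto u l (𝓝 0) := by
  rw [Metric.tendsto_nhds]
  intro η hη
  have hpos : 0 < |v₀| + 1 := by positivity
  obtain ⟨C, hC⟩ := h (η / (|v₀| + 1)) (by positivity)
  have h1 : Tendsto (fun i => η / (|v₀| + 1) * v i + C * w i) l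
      (𝓝 (η / (|v₀| + 1) * v₀ + C * 0)) := (hv.const_mul _).add (hw.const_mul _)
  have h2 : η / (|v₀| + 1) * v₀ + C * 0 < η := by
    rw [mul_zero, add_zero, div_mul_eq_mul_div, div_lt_iff₀ hpos]
    nlinarith [le_abs_self v₀]
  filter_upwards [hC, h1.eventually (gt_mem_nhds h2)] with i h3 h4
  rw [Real.dist_eq, sub_zero]
  linarith

variable {f : ℝ → ℝ} {x : ℝ}

theorem abs_integral_mul_le {R : ℝ → ℝ}
    (hR : ContinuousOn R (Set.Icc 0 1)) {B : ℝ → ℝ} (hBm : Measurable B)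
    (hB0 : ∀ y, 0 ≤ B y) {K : ℝ} (hB : ∀ y, B y ≤ K) {G : ℝ → ℝ} (hG : Continuous G)
    (h : ∀ y ∈ Set.Icc (0 : ℝ) 1, |R y| ≤ G y) :
    |∫ y in (0 : ℝ)..1, R y * B y| ≤ ∫ y in (0 : ℝ)..1, G y * B y := by
  have hB' : ∀ y, |B y| ≤ K := fun y => by rw [abs_of_nonneg (hB0 y)]; exact hB y
  refine (intervalIntegral.abs_integral_le_integral_abs zero_le_one).trans ?_
  refine intervalIntegral.integral_mono_on zero_le_one
    (intervalIntegrable_mul_bdd hR hBm hB').abs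
    (intervalIntegrable_mul_bdd hG.continuousOn hBm hB') fun y hy => ?_
  rw [abs_mul, abs_of_nonneg (hB0 y)]
  exact mul_le_mul_of_nonneg_right (h y hy) (hB0 y)

/-- Bound R by ε(y - x)⁴ + C(y - x)⁶: the rescaled fourth moment stays bounded, the sixth vanishes,
and ε is arbitrary. -/
theorem tendsto_integral_remainder (hx : x ∈ Set.Ioo (0 : ℝ) 1) {R : ℝ → ℝ}
    (hR : ContinuousOn R (Set.Icc 0 1))
    (ho : R =o[𝓝[Set.Icc 0 1] x] fun y => (y - x) ^ 4) :
    Tendsto (fun n : ℕ => ((n : ℝ) + 1) ^ 2 * ∫ y in (0 : ℝ)..1, R y * T (n + 1) x y)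
      atTop (𝓝 0) := by
  refine tendsto_zero_of_le_mul_add (tendsto_moment_four x) (tendsto_moment_six x) fun ε hε => ?_
  obtain ⟨C, -, hC⟩ := exists_remainder_bound (by decide) hR ho hε
  refine ⟨C, Eventually.of_forall fun n => ?_⟩
  have h1 := abs_integral_mul_le hR (measurable_T (n + 1) x)
    (T_nonneg hx (n + 1)) (T_le hx (n + 1)) (by fun_prop) hC
  have hint : ∀ j : ℕ, IntervalIntegrable (fun y => (y - x) ^ j * T (n + 1) x y) volume 0 1 :=
    fun j => intervalIntegrable_mul_bdd (by fun_prop) (measurable_T _ _) (abs_T_le hx _)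
  have h2 : ∫ y in (0 : ℝ)..1, (ε * (y - x) ^ 4 + C * (y - x) ^ (4 + 2)) * T (n + 1) x y =
      ε * (∫ y in (0 : ℝ)..1, (y - x) ^ 4 * T (n + 1) x y) +
        C * ∫ y in (0 : ℝ)..1, (y - x) ^ 6 * T (n + 1) x y := by
    rw [← intervalIntegral.integral_const_mul, ← intervalIntegral.integral_const_mul,
      ← intervalIntegral.integral_add ((hint 4).const_mul _) ((hint 6).const_mul _)]
    congr 1; funext y; ring
  rw [h2] at h1
  rw [abs_mul, abs_of_nonneg (by positivity)]
  refine (mul_le_mul_of_nonneg_left h1 (by positivity)).trans (le_of_eq (by ring))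

/-- Second-order expansion of the expectation of the Bernstein statistic. -/
theorem tendsto_integral_mul_T (hx : x ∈ Set.Ioo (0 : ℝ) 1)
    (hf : ContDiffOn ℝ 4 f (Set.Icc 0 1)) :
    ∃ D : ℝ, Tendsto (fun m : ℕ => (m : ℝ) ^ 2 *
      ((∫ y in (0 : ℝ)..1, f y * T m x y) - f x - D / m)) atTop (𝓝 (Delta2 f x)) := by
  set d : ℕ → ℝ := fun j => iteratedDerivWithin j f (Set.Icc 0 1) x with hd
  refine ⟨d 1 * (1 / 2 - x) + d 2 / 2 * (x * (1 - x)), ?_⟩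
  rw [← tendsto_add_atTop_iff_nat 1]
  set R : ℝ → ℝ := fun y => f y - taylorWithinEval f 4 (Set.Icc 0 1) x y with hRdef
  have hTay : ∀ y, taylorWithinEval f 4 (Set.Icc 0 1) x y =
      f x + d 1 * (y - x) ^ 1 + d 2 / 2 * (y - x) ^ 2 + d 3 / 6 * (y - x) ^ 3 +
        d 4 / 24 * (y - x) ^ 4 := by
    intro y
    simp only [taylor_within_apply, Finset.sum_range_succ, Finset.sum_range_zero, smul_eq_mul,
      Nat.factorial, iteratedDerivWithin_zero, hd]
    norm_num
    ring
  have hR : ContinuousOn R (Set.Icc 0 1) := by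
    refine hf.continuousOn.sub (Continuous.continuousOn ?_)
    rw [funext hTay]
    fun_prop
  have ho := taylor_isLittleO (convex_Icc (0 : ℝ) 1) (Set.Ioo_subset_Icc_self hx)
    (n := 4) (by exact_mod_cast hf)
  have h0 := tendsto_integral_remainder hx hR ho
  -- With q = x(1 - x) and order m = n + 1, the second moment is exactly q/m + (1/3 - 2q)/m². The
  -- q/m part belongs to D, the rest to Δ₂; the first moment contributes only to D.
  have hlim := ((h0.add (tendsto_const_nhds (x := d 2 / 2 * (1 / 3 - 2 * (x * (1 - x)))))).add
    ((tendsto_moment_three x).const_mul (d 3 / 6))).add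
    ((tendsto_moment_four x).const_mul (d 4 / 24))
  have e : 0 + d 2 / 2 * (1 / 3 - 2 * (x * (1 - x))) +
      d 3 / 6 * (5 / 2 * (x * (1 - x)) * (1 - 2 * x)) + d 4 / 24 * (3 * (x * (1 - x)) ^ 2) =
      Delta2 f x := by
    simp only [Delta2, hd]; ring
  rw [e] at hlim
  refine hlim.congr fun n => ?_
  have hint : ∀ j : ℕ, IntervalIntegrable (fun y => (y - x) ^ j * T (n + 1) x y) volume 0 1 :=
    fun j => intervalIntegrable_mul_bdd (by fun_prop) (measurable_T _ _) (abs_T_le hx _)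
  have hintR : IntervalIntegrable (fun y => R y * T (n + 1) x y) volume 0 1 :=
    intervalIntegrable_mul_bdd hR (measurable_T _ _) (abs_T_le hx _)
  have hintT : IntervalIntegrable (fun y => T (n + 1) x y) volume 0 1 := by
    simpa using hint 0
  have hsplit : ∫ y in (0 : ℝ)..1, f y * T (n + 1) x y =
      (∫ y in (0 : ℝ)..1, R y * T (n + 1) x y) + f x * 1 +
      d 1 * (∫ y in (0 : ℝ)..1, (y - x) ^ 1 * T (n + 1) x y) +
      d 2 / 2 * (∫ y in (0 : ℝ)..1, (y - x) ^ 2 * T (n + 1) x y) +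
      d 3 / 6 * (∫ y in (0 : ℝ)..1, (y - x) ^ 3 * T (n + 1) x y) +
      d 4 / 24 * (∫ y in (0 : ℝ)..1, (y - x) ^ 4 * T (n + 1) x y) := by
    rw [show f x * 1 = f x * ∫ y in (0 : ℝ)..1, T (n + 1) x y by rw [integral_T]]
    simp only [← intervalIntegral.integral_const_mul]
    have i0 := hintR.add (hintT.const_mul (f x))
    have i1 := i0.add ((hint 1).const_mul (d 1))
    have i2 := i1.add ((hint 2).const_mul (d 2 / 2))
    have i3 := i2.add ((hint 3).const_mul (d 3 / 6))
    rw [← intervalIntegral.integral_add hintR (hintT.const_mul (f x)),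
      ← intervalIntegral.integral_add i0 ((hint 1).const_mul (d 1)),
      ← intervalIntegral.integral_add i1 ((hint 2).const_mul (d 2 / 2)),
      ← intervalIntegral.integral_add i2 ((hint 3).const_mul (d 3 / 6)),
      ← intervalIntegral.integral_add i3 ((hint 4).const_mul (d 4 / 24))]
    congr 1
    funext y
    simp only [hRdef, hTay]
    ring
  have h1 := integral_sub_mul_T n x
  have h2 := integral_sub_sq_mul_T n x
  have hn : ((n : ℝ) + 1) ≠ 0 := by positivity
  have h1' : ∫ y in (0 : ℝ)..1, (y - x) ^ 1 * T (n + 1) x y = (1 / 2 - x) / (n + 1) := by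
    rw [eq_div_iff hn, ← h1]; ring
  have h2' : ∫ y in (0 : ℝ)..1, (y - x) ^ 2 * T (n + 1) x y =
      (n * (x * (1 - x)) + (1 / 3 - x * (1 - x))) / (n + 1) ^ 2 := by
    rw [eq_div_iff (by positivity), ← h2]; ring
  rw [hsplit, h1', h2']
  push_cast
  field_simp
  ring

/-- Bias reduction: the first-order terms of `2 T_{2N} - T_N` cancel. -/
theorem tendsto_integral_mul_Z (hx : x ∈ Set.Ioo (0 : ℝ) 1)
    (hf : ContDiffOn ℝ 4 f (Set.Icc 0 1)) :
    Tendsto (fun N : ℕ => (((2 * N : ℕ) : ℝ)) ^ 2 *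
      ((∫ y in (0 : ℝ)..1, f y * Z (2 * N) x y) - f x)) atTop (𝓝 (-2 * Delta2 f x)) := by
  obtain ⟨D, hD⟩ := tendsto_integral_mul_T hx hf
  have h2N : Tendsto (fun N : ℕ => 2 * N) atTop atTop := tendsto_id.const_mul_atTop' two_pos
  -- The weight of T_N is (2N)² = 4N², and the first-order terms cancel since 2 · D/(2N) = D/N.
  have h := ((hD.comp h2N).const_mul 2).sub (hD.const_mul 4)
  rw [show 2 * Delta2 f x - 4 * Delta2 f x = -2 * Delta2 f x by ring] at h
  refine h.congr' ?_
  filter_upwards [eventually_ge_atTop 1] with N hN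
  have hN' : (N : ℝ) ≠ 0 := by positivity
  have hint : ∀ m : ℕ, IntervalIntegrable (fun y => f y * T m x y) volume 0 1 :=
    fun m => intervalIntegrable_mul_bdd hf.continuousOn (measurable_T _ _) (abs_T_le hx _)
  have hZ : ∫ y in (0 : ℝ)..1, f y * Z (2 * N) x y =
      2 * (∫ y in (0 : ℝ)..1, f y * T (2 * N) x y) - ∫ y in (0 : ℝ)..1, f y * T N x y := by
    rw [← intervalIntegral.integral_const_mul,
      ← intervalIntegral.integral_sub ((hint _).const_mul 2) (hint _)]
    congr 1
    funext y
    rw [Z, Nat.mul_div_cancel_left N two_pos]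
    ring
  rw [hZ]
  simp only [Function.comp]
  push_cast
  field_simp
  ring

/-- Localization of integrals against quadratic kernels. -/
theorem tendsto_integral_mul_kernel (hx : x ∈ Set.Ioo (0 : ℝ) 1)
    (hf : ContinuousOn f (Set.Icc 0 1)) {k : ℕ → ℕ} (hk : Tendsto k atTop atTop)
    {B : ℕ → ℝ → ℝ} (hBm : ∀ n, Measurable (B n)) (hB0 : ∀ n y, 0 ≤ B n y)
    (hB : ∀ n y, B n y ≤ (k n + 1) * T (k n + 1) x y) {l : ℝ}
    (hl : Tendsto (fun n => (√((k n : ℝ) + 1))⁻¹ * ∫ y in (0 : ℝ)..1, B n y) atTop (𝓝 l)) :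
    Tendsto (fun n => (√((k n : ℝ) + 1))⁻¹ * ∫ y in (0 : ℝ)..1, f y * B n y) atTop
      (𝓝 (f x * l)) := by
  have hB' : ∀ n y, B n y ≤ ((k n : ℝ) + 1) * (k n + 1) := fun n y =>
    (hB n y).trans (mul_le_mul_of_nonneg_left (by simpa using T_le hx (k n + 1) y) (by positivity))
  have hBabs : ∀ n y, |B n y| ≤ ((k n : ℝ) + 1) * (k n + 1) := fun n y => by
    rw [abs_of_nonneg (hB0 n y)]; exact hB' n y
  have hint : ∀ {g : ℝ → ℝ}, ContinuousOn g (Set.Icc 0 1) → ∀ n,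
      IntervalIntegrable (fun y => g y * B n y) volume 0 1 :=
    fun hg n => intervalIntegrable_mul_bdd hg (hBm n) (hBabs n)
  have hintB : ∀ n, IntervalIntegrable (B n) volume 0 1 := fun n => by
    simpa using hint (g := fun _ => 1) continuousOn_const n
  -- Since B ≤ (k + 1)T, its second moment about x is at most k + 1 times an O(1/k) quantity, hence
  -- bounded, and the normalization kills it.
  have hw : Tendsto (fun n => (√((k n : ℝ) + 1))⁻¹ *
      (((k n : ℝ) + 1) * ∫ y in (0 : ℝ)..1, (y - x) ^ 2 * T (k n + 1) x y)) atTop (𝓝 0) := by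
    have hi := tendsto_inv_add_one.comp hk
    have h1 : Tendsto (fun n => √(((k n : ℝ) + 1)⁻¹) * (x * (1 - x) * (1 - ((k n : ℝ) + 1)⁻¹) +
        (1 / 3 - x * (1 - x)) * ((k n : ℝ) + 1)⁻¹)) atTop
        (𝓝 (√0 * (x * (1 - x) * (1 - 0) + (1 / 3 - x * (1 - x)) * 0))) :=
      hi.sqrt.mul (((hi.const_sub 1).const_mul _).add (hi.const_mul _))
    rw [Real.sqrt_zero, zero_mul] at h1
    refine h1.congr fun n => ?_
    have hn : ((k n : ℝ) + 1) ≠ 0 := by positivity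
    have h2 := integral_sub_sq_mul_T (k n) x
    rw [Real.sqrt_inv]
    congr 1
    rw [eq_comm, ← mul_right_inj' hn, ← mul_assoc, ← pow_two, h2]
    field_simp
    ring
  have hdiff : Tendsto (fun n => (√((k n : ℝ) + 1))⁻¹ *
      ∫ y in (0 : ℝ)..1, (f y - f x) * B n y) atTop (𝓝 0) := by
    refine tendsto_zero_of_le_mul_add hl hw fun ε hε => ?_
    have hR : ContinuousOn (fun y => f y - f x) (Set.Icc 0 1) := hf.sub continuousOn_const
    have ho : (fun y => f y - f x) =o[𝓝[Set.Icc 0 1] x] fun y => (y - x) ^ 0 := by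
      simp only [pow_zero]
      rw [isLittleO_one_iff, tendsto_sub_nhds_zero_iff]
      exact hf.continuousWithinAt (Set.Ioo_subset_Icc_self hx)
    obtain ⟨C, hC0, hC⟩ := exists_remainder_bound (by decide) hR ho hε
    refine ⟨C, Eventually.of_forall fun n => ?_⟩
    have h1 := abs_integral_mul_le hR (hBm n) (hB0 n) (hB' n) (by fun_prop) hC
    have h2 : ∫ y in (0 : ℝ)..1, (ε * (y - x) ^ 0 + C * (y - x) ^ (0 + 2)) * B n y ≤
        ε * (∫ y in (0 : ℝ)..1, B n y) +
          C * (((k n : ℝ) + 1) * ∫ y in (0 : ℝ)..1, (y - x) ^ 2 * T (k n + 1) x y) := by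
      rw [← intervalIntegral.integral_const_mul, ← intervalIntegral.integral_const_mul,
        ← intervalIntegral.integral_const_mul]
      have i1 : IntervalIntegrable (fun y => C * (((k n : ℝ) + 1) *
          ((y - x) ^ 2 * T (k n + 1) x y))) volume 0 1 :=
        ((intervalIntegrable_mul_bdd (by fun_prop) (measurable_T _ _) (abs_T_le hx _)).const_mul
          _).const_mul _
      rw [← intervalIntegral.integral_add ((hintB n).const_mul _) i1]
      refine intervalIntegral.integral_mono_on zero_le_one (hint (by fun_prop) n)
        (((hintB n).const_mul _).add i1) fun y _ => ?_
      have h3 := mul_le_mul_of_nonneg_left (hB n y) (mul_nonneg hC0 (sq_nonneg (y - x)))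
      calc (ε * (y - x) ^ 0 + C * (y - x) ^ (0 + 2)) * B n y
          = ε * B n y + C * (y - x) ^ 2 * B n y := by ring
        _ ≤ ε * B n y + C * (y - x) ^ 2 * ((k n + 1) * T (k n + 1) x y) := by linarith
        _ = _ := by ring
    rw [abs_mul, abs_of_nonneg (by positivity)]
    refine (mul_le_mul_of_nonneg_left (h1.trans h2) (by positivity)).trans (le_of_eq (by ring))
  have h := hdiff.add (hl.const_mul (f x))
  rw [zero_add] at h
  refine h.congr fun n => ?_
  have h1 : ∫ y in (0 : ℝ)..1, f y * B n y =
      (∫ y in (0 : ℝ)..1, (f y - f x) * B n y) + f x * ∫ y in (0 : ℝ)..1, B n y := by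
    rw [← intervalIntegral.integral_const_mul,
      ← intervalIntegral.integral_add
        (hint (g := fun y => f y - f x) (hf.sub continuousOn_const) n) ((hintB n).const_mul _)]
    congr 1; funext y; ring
  rw [h1]
  ring

theorem tendsto_integral_T_sq (hx : x ∈ Set.Ioo (0 : ℝ) 1) :
    Tendsto (fun n : ℕ => (√((n : ℝ) + 1))⁻¹ * ∫ y in (0 : ℝ)..1, T (n + 1) x y ^ 2) atTop
      (𝓝 (psi x)) := by
  have h1 := tendsto_sqrt_mul_sum_bw_sq hx
  have h2 : Tendsto (fun n : ℕ => √((1 - ((n : ℝ) + 1)⁻¹))) atTop (𝓝 √(1 - 0)) :=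
    (tendsto_inv_add_one.const_sub 1).sqrt
  have h3 := h1.div h2 (by simp)
  rw [sub_zero, Real.sqrt_one, div_one] at h3
  refine h3.congr' ?_
  filter_upwards [eventually_ge_atTop 1] with n hn
  have hn' : (0 : ℝ) < n := by exact_mod_cast hn
  have e : 1 - ((n : ℝ) + 1)⁻¹ = n / (n + 1) := by field_simp; ring
  have e2 : ((n + 1 : ℕ) : ℝ) = √((n : ℝ) + 1) * √((n : ℝ) + 1) := by
    rw [Real.mul_self_sqrt (by positivity)]; push_cast; rfl
  have e3 : √(n : ℝ) ≠ 0 := (Real.sqrt_pos.2 hn').ne'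
  have e4 : √((n : ℝ) + 1) ≠ 0 := (Real.sqrt_pos.2 (by positivity)).ne'
  simp only [Pi.div_apply]
  rw [integral_T_sq (by omega : 0 < n + 1), e, Real.sqrt_div hn'.le, e2, Nat.add_sub_cancel]
  field_simp

theorem tendsto_integral_T_mul_T (hx : x ∈ Set.Ioo (0 : ℝ) 1) :
    Tendsto (fun n : ℕ => (√(((2 * n + 1 : ℕ) : ℝ) + 1))⁻¹ *
      ∫ y in (0 : ℝ)..1, T (2 * (n + 1)) x y * T (n + 1) x y) atTop
      (𝓝 (√(2 / 3) * psi x)) := by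
  have h1 := tendsto_sqrt_mul_sum_bw_mul_bw hx
  have h2 : Tendsto (fun n : ℕ => √((1 - ((n : ℝ) + 1)⁻¹))) atTop (𝓝 √(1 - 0)) :=
    (tendsto_inv_add_one.const_sub 1).sqrt
  have h3 := (h1.div h2 (by simp)).const_mul (√2)⁻¹
  have h2' : √(2 : ℝ) ≠ 0 := by positivity
  rw [sub_zero, Real.sqrt_one, div_one, mul_assoc, inv_mul_cancel_left₀ h2'] at h3
  refine h3.congr' ?_
  filter_upwards [eventually_ge_atTop 1] with n hn
  have hn' : (0 : ℝ) < n := by exact_mod_cast hn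
  have e : 1 - ((n : ℝ) + 1)⁻¹ = n / (n + 1) := by field_simp; ring
  have e2 : ((n + 1 : ℕ) : ℝ) = √((n : ℝ) + 1) * √((n : ℝ) + 1) := by
    rw [Real.mul_self_sqrt (by positivity)]; push_cast; rfl
  have e3 : √(n : ℝ) ≠ 0 := (Real.sqrt_pos.2 hn').ne'
  have e4 : √((n : ℝ) + 1) ≠ 0 := (Real.sqrt_pos.2 (by positivity)).ne'
  have e5 : ((2 * n + 1 : ℕ) : ℝ) + 1 = 2 * ((n : ℝ) + 1) := by push_cast; ring
  simp only [Pi.div_apply]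
  rw [integral_T_mul_T (by omega : 0 < n + 1), e, Real.sqrt_div hn'.le, e2, Nat.add_sub_cancel, e5,
    Real.sqrt_mul zero_le_two, show 2 * (n + 1) - 1 = 2 * n + 1 by omega,
    show 2 * (n + 1) = 2 * n + 2 by ring]
  field_simp

/-- Variance of the bias-reduced statistic under the density `f`. -/
theorem tendsto_variance_Z (hx : x ∈ Set.Ioo (0 : ℝ) 1)
    (hf : ContDiffOn ℝ 4 f (Set.Icc 0 1)) :
    Tendsto (fun N : ℕ => (√((2 * N : ℕ) : ℝ))⁻¹ *
      ((∫ y in (0 : ℝ)..1, f y * Z (2 * N) x y ^ 2) -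
        (∫ y in (0 : ℝ)..1, f y * Z (2 * N) x y) ^ 2)) atTop (𝓝 (C3 * f x * psi x)) := by
  have hc := hf.continuousOn
  rw [← tendsto_add_atTop_iff_nat 1]
  have h2n : Tendsto (fun n : ℕ => 2 * n + 1) atTop atTop :=
    tendsto_atTop_mono (fun n => show n ≤ _ by omega) tendsto_id
  have hA := tendsto_integral_mul_kernel hx hc h2n (B := fun n y => T (2 * n + 1 + 1) x y ^ 2)
    (fun n => by fun_prop) (fun n y => sq_nonneg _)
    (fun n y => by
      rw [sq]
      exact mul_le_mul_of_nonneg_right (by simpa using T_le hx (2 * n + 1 + 1) y)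
        (T_nonneg hx _ _)) ((tendsto_integral_T_sq hx).comp h2n)
  have hB := tendsto_integral_mul_kernel hx hc tendsto_id (B := fun n y => T (n + 1) x y ^ 2)
    (fun n => by fun_prop) (fun n y => sq_nonneg _)
    (fun n y => by
      rw [sq]
      exact mul_le_mul_of_nonneg_right (by simpa using T_le hx (n + 1) y)
        (T_nonneg hx _ _)) (tendsto_integral_T_sq hx)
  have hC := tendsto_integral_mul_kernel hx hc h2n
    (B := fun n y => T (2 * (n + 1)) x y * T (n + 1) x y)
    (fun n => by fun_prop) (fun n y => mul_nonneg (T_nonneg hx _ _) (T_nonneg hx _ _))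
    (fun n y => by
      rw [mul_comm]
      refine mul_le_mul_of_nonneg_right ((T_le hx (n + 1) y).trans ?_) (T_nonneg hx _ _)
      push_cast; linarith [(Nat.cast_nonneg n : (0 : ℝ) ≤ n)]) (tendsto_integral_T_mul_T hx)
  have hs : Tendsto (fun n : ℕ => √((2 * (n + 1) : ℕ) : ℝ)) atTop atTop := by
    refine Real.tendsto_sqrt_atTop.comp (tendsto_natCast_atTop_atTop.comp ?_)
    exact tendsto_atTop_mono (fun n => show n ≤ _ by omega) tendsto_id
  have hE : Tendsto (fun N : ℕ => ∫ y in (0 : ℝ)..1, f y * Z (2 * N) x y) atTop (𝓝 (f x)) := by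
    have h1 := tendsto_integral_mul_Z hx hf
    have h2 : Tendsto (fun N : ℕ => (((2 * N : ℕ) : ℝ) ^ 2)⁻¹) atTop (𝓝 0) := by
      refine tendsto_inv_atTop_zero.comp ((tendsto_pow_atTop two_ne_zero).comp
        (tendsto_natCast_atTop_atTop.comp ?_))
      exact tendsto_id.const_mul_atTop' two_pos
    have h3 := (h2.mul h1).add_const (f x)
    rw [zero_mul, zero_add] at h3
    refine h3.congr' ?_
    filter_upwards [eventually_ge_atTop 1] with N hN
    have : ((2 * N : ℕ) : ℝ) ≠ 0 := by positivity
    field_simp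
    ring
  have hE2 := (hs.inv_tendsto_atTop).mul ((((tendsto_add_atTop_iff_nat 1).2 hE)).pow 2)
  -- The factor 1/√2 converts the coarse order n + 1 to the common order 2(n + 1). The squared mean
  -- is bounded, so it disappears after normalization.
  have h := (((hA.const_mul 4).sub (hC.const_mul 4)).add (hB.const_mul (√2)⁻¹)).sub hE2
  have e : 4 * (f x * psi x) - 4 * (f x * (√(2 / 3) * psi x)) + (√2)⁻¹ * (f x * psi x) -
      0 * f x ^ 2 = C3 * f x * psi x := by
    rw [C3]; ring
  rw [e] at h
  refine h.congr fun n => ?_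
  have hsq : ∫ y in (0 : ℝ)..1, f y * Z (2 * (n + 1)) x y ^ 2 =
      4 * (∫ y in (0 : ℝ)..1, f y * T (2 * (n + 1)) x y ^ 2) -
        4 * (∫ y in (0 : ℝ)..1, f y * (T (2 * (n + 1)) x y * T (n + 1) x y)) +
        ∫ y in (0 : ℝ)..1, f y * T (n + 1) x y ^ 2 := by
    have hi : ∀ m m' : ℕ, IntervalIntegrable (fun y => f y * (T m x y * T m' x y)) volume 0 1 :=
      fun m m' => intervalIntegrable_mul_bdd hc (by fun_prop) (C := m * m') fun y => by
        rw [abs_mul]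
        exact mul_le_mul (abs_T_le hx _ _) (abs_T_le hx _ _) (abs_nonneg _) (Nat.cast_nonneg _)
    simp only [pow_two (T _ _ _)]
    rw [← intervalIntegral.integral_const_mul, ← intervalIntegral.integral_const_mul,
      ← intervalIntegral.integral_sub ((hi _ _).const_mul 4) ((hi _ _).const_mul 4),
      ← intervalIntegral.integral_add (((hi _ _).const_mul 4).sub ((hi _ _).const_mul 4)) (hi _ _)]
    congr 1
    funext y
    rw [Z, Nat.mul_div_cancel_left _ two_pos]
    ring
  rw [hsq]
  have e1 : ((2 * n + 1 : ℕ) : ℝ) + 1 = ((2 * (n + 1) : ℕ) : ℝ) := by push_cast; ring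
  have e2 : 2 * n + 1 + 1 = 2 * (n + 1) := by ring
  have e3 : (√2)⁻¹ * (√((n : ℝ) + 1))⁻¹ = (√((2 * (n + 1) : ℕ) : ℝ))⁻¹ := by
    rw [← mul_inv, ← Real.sqrt_mul zero_le_two]; push_cast; rfl
  simp only [id, Pi.inv_apply]
  rw [← mul_assoc (√2)⁻¹, e3, e1, e2]
  ring

end Expectations

/-! ### Probability: recursions for the bias and variance of the estimator. -/

section Estimator

@[fun_prop]
theorem measurable_Z (m : ℕ) (x : ℝ) : Measurable (Z m x) := by
  unfold Z; fun_prop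

theorem abs_Z_le {x : ℝ} (hx : x ∈ Set.Ioo (0 : ℝ) 1) (m : ℕ) (y : ℝ) : |Z m x y| ≤ 3 * m := by
  have h1 := T_nonneg hx m y
  have h2 := T_le hx m y
  have h3 := T_nonneg hx (m / 2) y
  have h4 := T_le hx (m / 2) y
  have h5 : ((m / 2 : ℕ) : ℝ) ≤ m := by exact_mod_cast Nat.div_le_self m 2
  rw [Z, abs_le]
  constructor <;> linarith

variable {Ω : Type*} [MeasurableSpace Ω] {μ : Measure Ω} {f : ℝ → ℝ} {X : ℕ → Ω → ℝ}
  {γ : ℕ → ℝ} {M : ℕ → ℕ} {x : ℝ}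

theorem IsSample.integral_comp (hX : IsSample μ f X) (hf : ContinuousOn f (Set.Icc 0 1)) {n : ℕ}
    (hn : 1 ≤ n) {B : ℝ → ℝ} (hB : Measurable B) :
    ∫ ω, B (X n ω) ∂μ = ∫ y in (0 : ℝ)..1, f y * B y := by
  rw [← integral_map (hX.measurable n hn).aemeasurable hB.aestronglyMeasurable, hX.law n hn,
    integral_withDensity_eq_integral_toReal_smul₀
      (hf.aemeasurable measurableSet_Icc).ennreal_ofReal
      (Eventually.of_forall fun _ => ENNReal.ofReal_lt_top),
    intervalIntegral.integral_of_le zero_le_one, ← integral_Icc_eq_integral_Ioc]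
  refine setIntegral_congr_fun measurableSet_Icc fun y hy => ?_
  simp only [smul_eq_mul, ENNReal.toReal_ofReal (hX.nonneg y hy)]

variable [IsProbabilityMeasure μ]

theorem IsSample.memLp_Z (hX : IsSample μ f X) (hx : x ∈ Set.Ioo (0 : ℝ) 1) {n : ℕ} (hn : 1 ≤ n)
    (m : ℕ) : MemLp (fun ω => Z m x (X n ω)) 2 μ :=
  MemLp.of_bound ((measurable_Z m x).comp (hX.measurable n hn)).aestronglyMeasurable (3 * m)
    (Eventually.of_forall fun ω => abs_Z_le hx m (X n ω))

theorem IsSample.memLp_est (hX : IsSample μ f X) (hx : x ∈ Set.Ioo (0 : ℝ) 1) (n : ℕ) :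
    MemLp (est γ M X x n) 2 μ := by
  induction n with
  | zero => exact memLp_const 0
  | succ n ih => exact (ih.const_mul _).add ((hX.memLp_Z hx (by omega) _).const_mul _)

/-- The estimator is a linear combination of statistics of X₁, …, X_n, each independent of X_{k+1}.
Allowing every k ≥ n lets the induction on n keep the later observation fixed. -/
theorem IsSample.covariance_est (hX : IsSample μ f X) (hx : x ∈ Set.Ioo (0 : ℝ) 1) (m : ℕ)
    {n k : ℕ} (hk : n ≤ k) :
    cov[est γ M X x n, fun ω => Z m x (X (k + 1) ω); μ] = 0 := by
  have hZ := hX.memLp_Z hx (Nat.le_add_left 1 k) m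
  induction n with
  | zero => exact covariance_const_left 0
  | succ n ih =>
    have hZn := hX.memLp_Z hx (Nat.le_add_left 1 n) (M (n + 1))
    have hindep := (hX.indep.indepFun (by omega : n ≠ k)).comp (measurable_Z (M (n + 1)) x)
      (measurable_Z m x)
    have h := covariance_add_left ((hX.memLp_est (γ := γ) (M := M) hx n).const_mul (1 - γ (n + 1)))
      (hZn.const_mul (γ (n + 1))) hZ
    rw [covariance_const_mul_left, covariance_const_mul_left, ih (by omega)] at h
    have h2 : cov[fun ω => Z (M (n + 1)) x (X (n + 1) ω), fun ω => Z m x (X (k + 1) ω); μ] = 0 :=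
      hindep.covariance_eq_zero hZn hZ
    rw [h2, mul_zero, mul_zero, add_zero] at h
    exact h

theorem IsSample.bias_succ (hX : IsSample μ f X) (hf : ContinuousOn f (Set.Icc 0 1))
    (hx : x ∈ Set.Ioo (0 : ℝ) 1) (θ : ℝ) (n : ℕ) :
    bias μ (est γ M X x (n + 1)) θ = (1 - γ (n + 1)) * bias μ (est γ M X x n) θ +
      γ (n + 1) * ((∫ y in (0 : ℝ)..1, f y * Z (M (n + 1)) x y) - θ) := by
  have h1 := ((hX.memLp_est (γ := γ) (M := M) hx n).integrable one_le_two)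
  have h2 := (hX.memLp_Z hx (Nat.le_add_left 1 n) (M (n + 1))).integrable one_le_two
  simp only [bias, est]
  rw [integral_add (h1.const_mul _) (h2.const_mul _), integral_const_mul, integral_const_mul,
    hX.integral_comp hf (by omega) (measurable_Z _ x)]
  ring

theorem IsSample.variance_succ (hX : IsSample μ f X) (hf : ContinuousOn f (Set.Icc 0 1))
    (hx : x ∈ Set.Ioo (0 : ℝ) 1) (n : ℕ) :
    variance (est γ M X x (n + 1)) μ = (1 - γ (n + 1)) ^ 2 * variance (est γ M X x n) μ +
      γ (n + 1) ^ 2 * ((∫ y in (0 : ℝ)..1, f y * Z (M (n + 1)) x y ^ 2) -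
        (∫ y in (0 : ℝ)..1, f y * Z (M (n + 1)) x y) ^ 2) := by
  have h1 := hX.memLp_est (γ := γ) (M := M) hx n
  have h2 := hX.memLp_Z hx (Nat.le_add_left 1 n) (M (n + 1))
  have h := variance_add (h1.const_mul (1 - γ (n + 1))) (h2.const_mul (γ (n + 1)))
  rw [covariance_const_mul_left, covariance_const_mul_right, hX.covariance_est hx _ le_rfl,
    variance_const_mul, variance_const_mul, variance_eq_sub h2] at h
  have h3 : μ[(fun ω => Z (M (n + 1)) x (X (n + 1) ω)) ^ 2] =
      ∫ y in (0 : ℝ)..1, f y * Z (M (n + 1)) x y ^ 2 :=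
    hX.integral_comp hf (by omega) ((measurable_Z (M (n + 1)) x).pow_const 2)
  have h4 := hX.integral_comp hf (Nat.le_add_left 1 n) (measurable_Z (M (n + 1)) x)
  rw [h3, h4, mul_zero, mul_zero, mul_zero, add_zero] at h
  exact h

theorem mse_eq {g : Ω → ℝ} (hg : MemLp g 2 μ) (θ : ℝ) :
    mse μ g θ = bias μ g θ ^ 2 + variance g μ := by
  have h1 := variance_sub_const hg.aestronglyMeasurable θ
  have h2 := variance_eq_sub (hg.sub (memLp_const θ))
  have h3 : ∫ ω, (g - fun _ : Ω => θ) ω ∂μ = bias μ g θ := by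
    simp only [Pi.sub_apply]
    rw [integral_sub (hg.integrable one_le_two) (integrable_const _)]
    simp [bias]
  rw [h3] at h2
  have h4 : variance (g - fun _ => θ) μ = variance g μ := h1
  rw [h4] at h2
  have h5 : ∫ ω, ((g - fun _ : Ω => θ) ^ 2) ω ∂μ = mse μ g θ := rfl
  rw [h5] at h2
  linarith

end Estimator

/-! ### From limits of quotients to o-terms, and consequences of the lower bound on L. -/

section Asymptotics

theorem isLittleO_sub_of_tendsto_div {u s : ℕ → ℝ} {c : ℝ} (hs : ∀ᶠ n in atTop, s n ≠ 0)
    (h : Tendsto (fun n => u n / s n) atTop (𝓝 c)) : (fun n => u n - c * s n) =o[atTop] s := by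
  rw [isLittleO_iff_tendsto' (hs.mono fun n hn h0 => absurd h0 hn)]
  have h1 := h.sub_const c
  rw [sub_self] at h1
  refine h1.congr' ?_
  filter_upwards [hs] with n hn
  field_simp

theorem isLittleO_of_tendsto_div_zero {u s : ℕ → ℝ} (hs : ∀ᶠ n in atTop, s n ≠ 0)
    (h : Tendsto (fun n => u n / s n) atTop (𝓝 0)) : u =o[atTop] s := by
  simpa using isLittleO_sub_of_tendsto_div hs h

theorem GS.eventually_ne_zero {c : ℝ} {v : ℕ → ℝ} (hv : GS c v) : ∀ᶠ n in atTop, v n ≠ 0 :=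
  (eventually_ge_atTop 1).mono fun n hn => (hv.1 n hn).ne'

theorem eventually_div_le_of_lt {γ : ℕ → ℝ} {L : EReal}
    (hL : Tendsto (fun n : ℕ => (((n : ℝ) * γ n : ℝ) : EReal)) atTop (𝓝 L)) {t : ℝ}
    (ht : (t : EReal) < L) : ∀ᶠ n : ℕ in atTop, t / n ≤ γ n := by
  filter_upwards [hL.eventually (lt_mem_nhds ht), eventually_ge_atTop 1] with n h hn
  have hn' : (0 : ℝ) < n := by exact_mod_cast hn
  rw [div_le_iff₀ hn', mul_comm]
  exact (EReal.coe_lt_coe_iff.1 h).le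

/-- A real t' strictly between t and L gives ξ ≤ 1/t' < 1/t; this keeps the inequality strict and
treats L = ∞ at the same time. -/
theorem mul_lt_one_of_lt {γ : ℕ → ℝ} {L : EReal} {ξ : ℝ}
    (hL : Tendsto (fun n : ℕ => (((n : ℝ) * γ n : ℝ) : EReal)) atTop (𝓝 L))
    (hξ : Tendsto (fun n : ℕ => ((n : ℝ) * γ n)⁻¹) atTop (𝓝 ξ)) {t : ℝ} (ht0 : 0 < t)
    (ht : (t : EReal) < L) : t * ξ < 1 := by
  obtain ⟨t', h1, h2⟩ := EReal.lt_iff_exists_real_btwn.1 ht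
  have h1' : t < t' := EReal.coe_lt_coe_iff.1 h1
  have h3 : ξ ≤ t'⁻¹ := by
    refine le_of_tendsto hξ ?_
    filter_upwards [hL.eventually (lt_mem_nhds h2)] with n h
    have h' := EReal.coe_lt_coe_iff.1 h
    exact inv_anti₀ (ht0.trans h1') h'.le
  calc t * ξ ≤ t * t'⁻¹ := mul_le_mul_of_nonneg_left h3 ht0.le
    _ < 1 := by rw [← div_eq_mul_inv, div_lt_one (ht0.trans h1')]; exact h1'

end Asymptotics

end RecBernstein

/-! ### The main theorem. -/

open RecBernstein

theorem proposition1 {Ω : Type*} [MeasurableSpace Ω] (μ : Measure Ω) [IsProbabilityMeasure μ]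
    (f : ℝ → ℝ) (X : ℕ → Ω → ℝ) (hX : RecBernstein.IsSample μ f X)
    -- stepsizes, real order sequence, and the even integer orders that round it
    (γ m : ℕ → ℝ) (M : ℕ → ℕ)
    (hM : ∀ n, 1 ≤ n → 0 < M n ∧ Even (M n))
    (hMm : Tendsto (fun n => (M n : ℝ) / m n) atTop (𝓝 1))
    -- (A1)
    (hf : ContDiffOn ℝ 4 f (Set.Icc 0 1))
    -- (A2)
    (α : ℝ) (hα : α ∈ Set.Ioc (1 / 2 : ℝ) 1) (hγ : RecBernstein.GS (-α) γ)
    -- (A3)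
    (a : ℝ) (ha : a ∈ Set.Ioo (0 : ℝ) 1) (hm : RecBernstein.GS a m)
    -- (A4): `L = lim n γ_n`, which may be `+∞`, and `ξ = lim (n γ_n)⁻¹`
    (L : EReal) (hL : Tendsto (fun n : ℕ => (((n : ℝ) * γ n : ℝ) : EReal)) atTop (𝓝 L))
    (hL_min : ((min (2 * a) ((2 * α - a) / 4) : ℝ) : EReal) < L)
    (ξ : ℝ) (hξ : Tendsto (fun n : ℕ => ((n : ℝ) * γ n)⁻¹) atTop (𝓝 ξ))
    (x : ℝ) (hx : x ∈ Set.Ioo (0 : ℝ) 1) :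
    let b : ℕ → ℝ := fun n => RecBernstein.bias μ (RecBernstein.est γ M X x n) (f x)
    let v : ℕ → ℝ := fun n => variance (RecBernstein.est γ M X x n) μ
    let e : ℕ → ℝ := fun n => RecBernstein.mse μ (RecBernstein.est γ M X x n) (f x)
    -- 1. bias
    (a ≤ 2 / 9 * α → RecBernstein.BiasExpansion b m f x a ξ) ∧
    (2 / 9 * α < a → b =o[atTop] fun n => √(γ n * √(m n))) ∧
    -- 2. variance
    (2 / 9 * α ≤ a → RecBernstein.VarExpansion v γ m f x a α ξ) ∧
    (a < 2 / 9 * α → v =o[atTop] fun n => (m n ^ 4)⁻¹) ∧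
    -- 3. both expansions simultaneously
    (((max (2 * a) ((2 * α - a) / 4) : ℝ) : EReal) < L →
      0 < 1 - 2 * a * ξ ∧ 0 < 4 - (2 * α - a) * ξ ∧
        RecBernstein.BiasExpansion b m f x a ξ ∧ RecBernstein.VarExpansion v γ m f x a α ξ) ∧
    -- 4. mean squared error
    (a < 2 / 9 * α →
      (fun n => e n -
          RecBernstein.Delta2 f x ^ 2 * (m n ^ 4)⁻¹ * (4 / (1 - 2 * a * ξ) ^ 2))
        =o[atTop] fun n => (m n ^ 4)⁻¹) ∧
    (a = 2 / 9 * α →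
      (fun n => e n -
          (RecBernstein.Delta2 f x ^ 2 * (m n ^ 4)⁻¹ * (4 / (1 - 2 * a * ξ) ^ 2) +
            RecBernstein.C3 * f x * RecBernstein.psi x * (γ n * √(m n)) *
              (2 / (4 - (2 * α - a) * ξ))))
        =o[atTop] fun n => (m n ^ 4)⁻¹ + γ n * √(m n)) ∧
    (2 / 9 * α < a →
      (fun n => e n -
          RecBernstein.C3 * f x * RecBernstein.psi x * (γ n * √(m n)) *
            (2 / (4 - (2 * α - a) * ξ)))
        =o[atTop] fun n => γ n * √(m n)) := by
  intro b v e
  obtain ⟨hα1, hα2⟩ := hα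
  obtain ⟨ha0, ha1⟩ := ha
  have hcont := hf.continuousOn
  have ht1 : 0 < 2 * a := by linarith
  -- Uses α > 1/2 and a < 1. Positivity of both thresholds gives γ_n ≥ κ/n eventually with κ > 0, so
  -- the gains have divergent sum.
  have ht2 : 0 < (2 * α - a) / 4 := by linarith
  have hγ0 : Tendsto γ atTop (𝓝 0) := hγ.tendsto_zero (by linarith)
  have hκ : 0 < min (2 * a) ((2 * α - a) / 4) := lt_min ht1 ht2
  have hγκ := eventually_div_le_of_lt hL hL_min
  -- the scales
  have hs1 : GS (-(2 * a)) fun n => (m n ^ 2)⁻¹ := by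
    have h := (hm.mul hm).inv
    simpa only [← sq, ← two_mul] using h
  have hs2 : GS (-(α - a / 2)) fun n => γ n * √(m n) := by
    convert! hγ.mul hm.sqrt using 1
    ring
  have hs3 : GS (-((2 * α - a) / 4)) fun n => √(γ n * √(m n)) := by
    convert! hs2.sqrt using 1
    ring
  have hs4 : GS (-(4 * a)) fun n => (m n ^ 4)⁻¹ := by
    convert! hs1.mul hs1 using 1
    · ring
    · funext n; rw [← mul_inv]; ring
  have hm_top : Tendsto m atTop atTop := hm.tendsto_atTop ha0
  have hm_pos : ∀ᶠ n in atTop, 0 < m n := hm_top.eventually_gt_atTop 0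
  have hM_top : Tendsto M atTop atTop := by
    rw [← tendsto_natCast_atTop_iff (R := ℝ)]
    refine (hMm.pos_mul_atTop one_pos hm_top).congr' ?_
    filter_upwards [hm_pos] with n hn
    field_simp
  have hMN : ∀ n, 1 ≤ n → 2 * (M n / 2) = M n := fun n hn => Nat.two_mul_div_two_of_even (hM n hn).2
  have hN_top : Tendsto (fun n => M n / 2) atTop atTop :=
    (Nat.tendsto_div_const_atTop two_ne_zero).comp hM_top
  -- one-observation mean and variance
  set wb : ℕ → ℝ := fun n => (∫ y in (0 : ℝ)..1, f y * Z (M n) x y) - f x with hwb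
  set wv : ℕ → ℝ := fun n => (∫ y in (0 : ℝ)..1, f y * Z (M n) x y ^ 2) -
    (∫ y in (0 : ℝ)..1, f y * Z (M n) x y) ^ 2 with hwv
  have hwb_lim : Tendsto (fun n => wb n / (m n ^ 2)⁻¹) atTop (𝓝 (-2 * Delta2 f x)) := by
    have h := ((tendsto_integral_mul_Z hx hf).comp hN_top).div (hMm.pow 2) (by norm_num)
    rw [one_pow, div_one] at h
    refine h.congr' ?_
    filter_upwards [hm_pos, eventually_ge_atTop 1] with n hn hn1
    have hMpos : (M n : ℝ) ≠ 0 := by exact_mod_cast (hM n hn1).1.ne'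
    simp only [Pi.div_apply, Function.comp, hMN n hn1, hwb]
    field_simp
  have hwv_lim : Tendsto (fun n => wv n / √(m n)) atTop (𝓝 (C3 * f x * psi x)) := by
    have h := ((tendsto_variance_Z hx hf).comp hN_top).mul hMm.sqrt
    rw [Real.sqrt_one, mul_one] at h
    refine h.congr' ?_
    filter_upwards [hm_pos, eventually_ge_atTop 1] with n hn hn1
    have hMpos : (0 : ℝ) < M n := by exact_mod_cast (hM n hn1).1
    have h1 : √(M n : ℝ) ≠ 0 := (Real.sqrt_pos.2 hMpos).ne'
    simp only [Function.comp, hMN n hn1, hwv]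
    rw [Real.sqrt_div hMpos.le]
    field_simp
  have hb : ∀ n, b (n + 1) = (1 - γ (n + 1) * 1) * b n + γ (n + 1) * wb (n + 1) := fun n => by
    rw [mul_one]; exact hX.bias_succ hcont hx (f x) n
  -- (1 - γ)² = 1 - γ(2 - γ), so the rate is θ = 2 - γ, with limit 2.
  have hv : ∀ n, v (n + 1) = (1 - γ (n + 1) * (2 - γ (n + 1))) * v n +
      γ (n + 1) * (γ (n + 1) * wv (n + 1)) := fun n =>
    (hX.variance_succ hcont hx n).trans (by simp only [v, hwv]; ring)
  have he : ∀ n, e n = b n ^ 2 + v n := fun n => mse_eq (hX.memLp_est hx n) (f x)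
  have hθ : Tendsto (fun n => 2 - γ n) atTop (𝓝 2) := by simpa using hγ0.const_sub 2
  -- the four expansions
  have hbias : 2 * a * ξ < 1 →
      Tendsto (fun n => b n / (m n ^ 2)⁻¹) atTop (𝓝 (-2 * Delta2 f x / (1 - 2 * a * ξ))) := fun h =>
    tendsto_div_of_recursion (θ := fun _ => 1) hκ hγ0 hγκ hξ tendsto_const_nhds hs1 (by linarith)
      hwb_lim hb
  have hbias' : 2 * a * ξ < 1 → BiasExpansion b m f x a ξ := fun h => by
    refine (isLittleO_sub_of_tendsto_div hs1.eventually_ne_zero (hbias h)).congr_left fun n => ?_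
    ring
  have hvar : (2 * α - a) / 4 * ξ < 1 → VarExpansion v γ m f x a α ξ := fun h => by
    have hw : Tendsto (fun n => γ n * wv n / (γ n * √(m n))) atTop (𝓝 (C3 * f x * psi x)) := by
      refine hwv_lim.congr' ?_
      filter_upwards [eventually_ge_atTop 1] with n hn
      rw [mul_div_mul_left _ _ (hγ.1 n hn).ne']
    have h1 := tendsto_div_of_recursion hκ hγ0 hγκ hξ hθ hs2 (by linarith) hw hv
    refine (isLittleO_sub_of_tendsto_div hs2.eventually_ne_zero h1).congr_left fun n => ?_
    have e1 : 4 - (2 * α - a) * ξ ≠ 0 := by linarith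
    have e2 : 2 - (α - a / 2) * ξ ≠ 0 := by linarith
    have e3 : 2 / (4 - (2 * α - a) * ξ) = 1 / (2 - (α - a / 2) * ξ) := by
      rw [div_eq_div_iff e1 e2]; ring
    rw [e3]
    ring
  have hbias_small : 2 / 9 * α < a → (2 * α - a) / 4 * ξ < 1 →
      b =o[atTop] fun n => √(γ n * √(m n)) := fun hlt h => by
    -- The ratio of m⁻² to √(γ√m) has exponent -2a + (2α - a)/4, negative exactly when a > 2α/9.
    have hz := (hs1.mul hs3.inv).tendsto_zero (by linarith)
    have hw : Tendsto (fun n => wb n / √(γ n * √(m n))) atTop (𝓝 0) := by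
      have h1 := hwb_lim.mul hz
      rw [mul_zero] at h1
      refine h1.congr' ?_
      filter_upwards [hm_pos] with n hn
      field_simp
    have h1 := tendsto_div_of_recursion (θ := fun _ => 1) hκ hγ0 hγκ hξ tendsto_const_nhds hs3
      (by linarith) hw hb
    rw [zero_div] at h1
    exact isLittleO_of_tendsto_div_zero hs3.eventually_ne_zero h1
  have hvar_small : a < 2 / 9 * α → 2 * a * ξ < 1 → v =o[atTop] fun n => (m n ^ 4)⁻¹ :=
      fun hlt h => by
    -- The ratio of γ√m to m⁻⁴ has exponent 4a - (α - a/2), negative exactly when a < 2α/9. The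
    -- limiting rate 2 - 4aξ is positive because 2aξ < 1.
    have hz := (hs2.mul hs4.inv).tendsto_zero (by linarith)
    have hw : Tendsto (fun n => γ n * wv n / (m n ^ 4)⁻¹) atTop (𝓝 0) := by
      have h1 := hwv_lim.mul hz
      rw [mul_zero] at h1
      refine h1.congr' ?_
      filter_upwards [hm_pos] with n hn
      have : √(m n) ≠ 0 := (Real.sqrt_pos.2 hn).ne'
      field_simp
    have h1 := tendsto_div_of_recursion hκ hγ0 hγκ hξ hθ hs4 (by linarith) hw hv
    rw [zero_div] at h1
    exact isLittleO_of_tendsto_div_zero hs4.eventually_ne_zero h1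
  have hsq : 2 * a * ξ < 1 → (fun n => b n ^ 2 -
      Delta2 f x ^ 2 * (m n ^ 4)⁻¹ * (4 / (1 - 2 * a * ξ) ^ 2)) =o[atTop] fun n => (m n ^ 4)⁻¹ :=
      fun h => by
    have h1 : Tendsto (fun n => b n ^ 2 / (m n ^ 4)⁻¹) atTop
        (𝓝 ((-2 * Delta2 f x / (1 - 2 * a * ξ)) ^ 2)) := by
      refine ((hbias h).pow 2).congr fun n => ?_
      rw [div_pow, ← inv_pow, ← inv_pow, ← pow_mul]
    refine (isLittleO_sub_of_tendsto_div hs4.eventually_ne_zero h1).congr_left fun n => ?_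
    rw [div_pow]
    ring
  -- the regimes
  have hle : a ≤ 2 / 9 * α → 2 * a * ξ < 1 := fun h => by
    refine mul_lt_one_of_lt hL hξ ht1 ?_
    -- 2a ≤ (2α - a)/4 is equivalent to a ≤ 2α/9, so the minimum in (A4) is precisely the threshold
    -- needed in each regime.
    rwa [min_eq_left (by linarith)] at hL_min
  have hge : 2 / 9 * α ≤ a → (2 * α - a) / 4 * ξ < 1 := fun h => by
    refine mul_lt_one_of_lt hL hξ ht2 ?_
    rwa [min_eq_right (by linarith)] at hL_min
  refine ⟨fun h => hbias' (hle h), fun h => hbias_small h (hge h.le), fun h => hvar (hge h),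
    fun h => hvar_small h (hle h.le), fun h => ?_, fun h => ?_, fun h => ?_, fun h => ?_⟩
  · have h1 := mul_lt_one_of_lt hL hξ ht1
      (lt_of_le_of_lt (EReal.coe_le_coe_iff.2 (le_max_left _ _)) h)
    have h2 := mul_lt_one_of_lt hL hξ ht2
      (lt_of_le_of_lt (EReal.coe_le_coe_iff.2 (le_max_right _ _)) h)
    exact ⟨by linarith, by linarith, hbias' h1, hvar h2⟩
  · refine ((hsq (hle h.le)).add (hvar_small h (hle h.le))).congr_left fun n => ?_
    rw [he]; ring
  -- At equality neither scale is known to dominate, so the errors are added against the sum of the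
  -- norms of both scales, which are positive for n ≥ 1.
  · have h1 := (hsq (hle h.le)).add_add (hvar (hge h.ge))
    refine (h1.congr_left (f₂ := _) fun n => ?_).congr' EventuallyEq.rfl ?_
    · rw [he]; ring
    · filter_upwards [eventually_ge_atTop 1] with n hn
      rw [Real.norm_of_nonneg (hs4.1 n hn).le, Real.norm_of_nonneg (hs2.1 n hn).le]
  · have h1 : (fun n => b n ^ 2) =o[atTop] fun n => γ n * √(m n) := by
      refine ((hbias_small h (hge h.le)).pow two_pos).congr' EventuallyEq.rfl ?_
      filter_upwards [eventually_ge_atTop 1] with n hn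
      exact Real.sq_sqrt (hs2.1 n hn).le
    refine (h1.add (hvar (hge h.le))).congr_left fun n => ?_
    rw [he]; ring
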